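/- Let $\mathcal H$ be a finite-dimensional complex Hilbert space of dimension $d$, and let $\mathcal P=(\mathcal P_t)_{t\ge 0}$ be a quantum Markov semigroup on $\mathcal B(\mathcal H)$, that is, a continuous one-parameter semigroup of completely positive linear maps with $\mathcal P_t(I)=I$. Let $\mathcal L=\lim_{t\to 0^+}\frac1t(\mathcal P_t-\mathrm{id})$ be its generator. Assume that $\mathcal P$ has a faithful invariant state, i.e. a positive definite $\sigma$ with $\operatorname{Tr}\sigma=1$ and $\operatorname{Tr}[\sigma\mathcal P_t(X)]=\operatorname{Tr}[\sigma X]$ for all $t\ge 0$ and all $X$. Let $$\mathcal N(\mathcal P)=\{X:\ \mathcal P_t(X^*Y)=\mathcal P_t(X)^*\mathcal P_t(Y),\ \mathcal P_t(YX^*)=\mathcal P_t(Y)\mathcal P_t(X)^*\ \ \forall t\ge 0,\ \forall Y\in\mathcal B(\mathcal H)\}$$ be the decoherence-free algebra, and let $E_{\mathcal N}$ be the unique completely positive projection of $\mathcal B(\mathcal H)$ onto $\mathcal N(\mathcal P)$ that is compatible with the invariant states and whose kernel is $\{X:\lim_{t\to\infty}\mathcal P_t(X)=0\}$. Let $E_{\mathcal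 N*}$ be its predual, $\operatorname{Tr}[E_{\mathcal N}(X)Y]=\operatorname{Tr}[XE_{\mathcal N*}(Y)]$, and put $\sigma_{\operatorname{Tr}}=E_{\mathcal N*}(I/d)$. Write $\langle X,Y\rangle=\operatorname{Tr}[\sigma_{\operatorname{Tr}}^{1/2}X^*\sigma_{\operatorname{Tr}}^{1/2}Y]$. For $p>1$, with $\frac1p+\frac1q=1$, and $X\ge 0$, the $p$-Dirichlet form is $$\mathcal E_{p,\mathcal L}(X)=-\frac{p}{2(p-1)}\Big\langle \sigma_{\operatorname{Tr}}^{-\frac1{2q}}\big|\sigma_{\operatorname{Tr}}^{\frac1{2p}}X\sigma_{\operatorname{Tr}}^{\frac1{2p}}\big|^{p/q}\sigma_{\operatorname{Tr}}^{-\frac1{2q}},\ \mathcal L(X)\Big\rangle ,$$ and for $p=1$ it is $$\mathcal E_{1,\mathcal L}(X)=-\tfrac12\operatorname{Tr}\big[\sigma_{\operatorname{Tr}}^{1/2}\mathcal L(X)\sigma_{\operatorname{Tr}}^{1/2}\big(\log(\sigma_{\operatorname{Tr}}^{1/2}X\sigma_{\operatorname{Tr}}^{1/2})-\log\sigma_{\operatorname{Tr}}\big)\big]\in(-\infty,+\infty],$$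 with the conventions $\log 0=-\infty$ on the kernel of $\sigma_{\operatorname{Tr}}^{1/2}X\sigma_{\operatorname{Tr}}^{1/2}$ and $0\cdot\infty=0$. **Theorem 4.1.** Suppose that $\mathcal P$ satisfies the $\sigma_{\operatorname{Tr}}$-DBC property, i.e. $\operatorname{Tr}[\sigma_{\operatorname{Tr}}X^*\mathcal P_t(Y)]=\operatorname{Tr}[\sigma_{\operatorname{Tr}}\mathcal P_t(X^*)Y]$ for all $X,Y\in\mathcal B(\mathcal H)$ and all $t\ge 0$. Then $\mathcal P$ is strongly $\mathbb L_p$-regular for all $p\ge 1$: for every $p\ge 1$ and every positive semidefinite $X\in\mathcal B(\mathcal H)$, $$\mathcal E_{p,\mathcal L}(X)\ \ge\ \frac2p\,\mathcal E_{2,\mathcal L}\Big(\sigma_{\operatorname{Tr}}^{-\frac14}\big|\sigma_{\operatorname{Tr}}^{\frac1{2p}}X\sigma_{\operatorname{Tr}}^{\frac1{2p}}\big|^{p/2}\sigma_{\operatorname{Tr}}^{-\frac14}\Big).$$ -/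

import Mathlib

open Filter Topology
open scoped NNReal InnerProductSpace CStarAlgebra

noncomputable section

namespace QMS

section Basic

variable {H : Type*} [NormedAddCommGroup H] [InnerProductSpace ℂ H] [CompleteSpace H]

/-- The trace of an operator. -/
def tr (X : H →L[ℂ] H) : ℂ := LinearMap.trace ℂ H (X : H →ₗ[ℂ] H)

/-- A linear map on `B(H)` is completely positive (Mathlib's notion, as a proposition). -/
def IsCompletelyPositive (Φ : (H →L[ℂ] H) →ₗ[ℂ] (H →L[ℂ] H)) : Prop :=
  ∃ Ψ : (H →L[ℂ] H) →CP (H →L[ℂ] H), Ψ.toLinearMap = Φ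

/-- A density matrix: a positive semidefinite operator of trace one. -/
def IsState (ρ : H →L[ℂ] H) : Prop := 0 ≤ ρ ∧ tr ρ = 1

/-- A faithful (that is, positive definite) density matrix. -/
def IsFaithfulState (ρ : H →L[ℂ] H) : Prop := IsStrictlyPositive ρ ∧ tr ρ = 1

/-- The predual `Φ_*` of a linear map `Φ` on `B(H)`, written in an orthonormal basis `b` as
`∑ i j, Tr[Φ(|b i⟩⟨b j|) Y] |b j⟩⟨b i|`. It is characterized by `tr_predual` below. -/
def predual [FiniteDimensional ℂ H] (Φ : (H →L[ℂ] H) →ₗ[ℂ] (H →L[ℂ] H)) (Y : H →L[ℂ] H) :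
    H →L[ℂ] H :=
  ∑ i, ∑ j,
    tr (Φ (InnerProductSpace.rankOne ℂ (stdOrthonormalBasis ℂ H i) (stdOrthonormalBasis ℂ H j))
        * Y) •
      InnerProductSpace.rankOne ℂ (stdOrthonormalBasis ℂ H j) (stdOrthonormalBasis ℂ H i)

/-- The KMS scalar product `⟨X, Y⟩_σ = Tr[σ^{1/2} X^* σ^{1/2} Y]`. -/
def kms (σ X Y : H →L[ℂ] H) : ℂ :=
  tr (σ ^ (1 / 2 : ℝ) * star X * σ ^ (1 / 2 : ℝ) * Y)

end Basic

/-- A quantum Markov semigroup on `B(H)` (Heisenberg picture): a continuous one-parameter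
semigroup of completely positive unital maps. -/
structure QuantumMarkovSemigroup (H : Type*) [NormedAddCommGroup H] [InnerProductSpace ℂ H]
    [CompleteSpace H] where
  toMap : ℝ≥0 → (H →L[ℂ] H) →ₗ[ℂ] (H →L[ℂ] H)
  map_zero : toMap 0 = LinearMap.id
  map_add : ∀ s t, toMap (s + t) = toMap s ∘ₗ toMap t
  completelyPositive : ∀ t, IsCompletelyPositive (toMap t)
  unital : ∀ t, toMap t 1 = 1
  continuous : ∀ X, Continuous fun t => toMap t X

section Semigroup

variable {H : Type*} [NormedAddCommGroup H] [InnerProductSpace ℂ H] [CompleteSpace H]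

/-- `L` is the generator of `P`: `L = lim_{t → 0+} (P_t - id) / t`. -/
def IsGenerator (P : QuantumMarkovSemigroup H) (L : (H →L[ℂ] H) →ₗ[ℂ] (H →L[ℂ] H)) : Prop :=
  ∀ X, Tendsto (fun t : ℝ≥0 => (((t : ℝ) : ℂ))⁻¹ • (P.toMap t X - X)) (𝓝[>] 0) (𝓝 (L X))

open Classical in
/-- The Lindbladian of `P`: the limit `lim_{t → 0+} (P_t - id) / t`. In finite dimension it
always exists (the value `0` is never taken by default), and it is unique. -/
def lindbladian (P : QuantumMarkovSemigroup H) : (H →L[ℂ] H) →ₗ[ℂ] (H →L[ℂ] H) :=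
  if h : ∃ L, IsGenerator P L then h.choose else 0

/-- `σ` is an invariant state of `P`: `Tr[σ P_t(X)] = Tr[σ X]`. -/
def IsInvariantState (P : QuantumMarkovSemigroup H) (σ : H →L[ℂ] H) : Prop :=
  IsState σ ∧ ∀ t X, tr (σ * P.toMap t X) = tr (σ * X)

/-- `P` has a faithful invariant state. -/
def HasFaithfulInvariantState (P : QuantumMarkovSemigroup H) : Prop :=
  ∃ σ, IsFaithfulState σ ∧ IsInvariantState P σ

/-- The decoherence-free algebra `N(P)`. -/
def dfAlgebra (P : QuantumMarkovSemigroup H) : Set (H →L[ℂ] H) :=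
  {X | ∀ (t : ℝ≥0) (Y : H →L[ℂ] H),
    P.toMap t (star X * Y) = star (P.toMap t X) * P.toMap t Y ∧
    P.toMap t (Y * star X) = P.toMap t Y * star (P.toMap t X)}

/-- `E` is the conditional expectation onto the decoherence-free algebra: a completely positive
projection with range `N(P)`, compatible with the invariant states of `P`, whose kernel is the set
of the observables that vanish as `t → ∞`. -/
structure IsDFExpectation (P : QuantumMarkovSemigroup H)
    (E : (H →L[ℂ] H) →ₗ[ℂ] (H →L[ℂ] H)) : Prop where
  completelyPositive : IsCompletelyPositive E
  idempotent : E ∘ₗ E = E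
  range_eq : Set.range E = dfAlgebra P
  compatible : ∀ σ, IsInvariantState P σ → ∀ X, tr (σ * E X) = tr (σ * X)
  ker_iff : ∀ X, E X = 0 ↔ Tendsto (fun t : ℝ≥0 => P.toMap t X) atTop (𝓝 0)

open Classical in
/-- The conditional expectation `E_N` onto the decoherence-free algebra. In finite dimension it
exists for every semigroup that has a faithful invariant state (so that `0` is never taken by
default), and it is unique, since its range and its kernel are prescribed. -/
def dfExpectation (P : QuantumMarkovSemigroup H) : (H →L[ℂ] H) →ₗ[ℂ] (H →L[ℂ] H) :=
  if h : ∃ E, IsDFExpectation P E then h.choose else 0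

/-- The reference state `σ_Tr = E_{N*}(I / d)`, with `d = dim H`. -/
def sigmaTr [FiniteDimensional ℂ H] (P : QuantumMarkovSemigroup H) : H →L[ℂ] H :=
  predual (dfExpectation P) (((Module.finrank ℂ H : ℂ))⁻¹ • (1 : H →L[ℂ] H))

/-- The `σ_Tr`-DBC property: `P` has a faithful invariant state and each `P_t` is selfadjoint
for the scalar product `(X, Y) ↦ Tr[σ_Tr X^* Y]`. -/
def IsDBC [FiniteDimensional ℂ H] (P : QuantumMarkovSemigroup H) : Prop :=
  HasFaithfulInvariantState P ∧
    ∀ (X Y : H →L[ℂ] H) (t : ℝ≥0),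
      tr (sigmaTr P * (star X * P.toMap t Y)) = tr (sigmaTr P * (P.toMap t (star X) * Y))

end Semigroup

section Dirichlet

variable {H : Type*} [NormedAddCommGroup H] [InnerProductSpace ℂ H] [CompleteSpace H]

/-- The operator `I_{r,p}(X) = σ^{-1/(2r)} |σ^{1/(2p)} X σ^{1/(2p)}|^{p/r} σ^{-1/(2r)}`. -/
def powerMap (σ : H →L[ℂ] H) (r p : ℝ) (X : H →L[ℂ] H) : H →L[ℂ] H :=
  σ ^ (-(1 / (2 * r)))
    * CFC.abs (σ ^ (1 / (2 * p)) * X * σ ^ (1 / (2 * p))) ^ (p / r)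
    * σ ^ (-(1 / (2 * r)))

/-- The `p`-Dirichlet form for `p > 1`, with `q = p / (p - 1)` the Hölder conjugate of `p`:
`- p / (2 (p - 1)) ⟨I_{q,p}(X), L(X)⟩_σ`. (This is a real number when `X` is selfadjoint and
`L` preserves selfadjointness.) -/
def pDirichletReal (σ : H →L[ℂ] H) (L : (H →L[ℂ] H) →ₗ[ℂ] (H →L[ℂ] H)) (p : ℝ)
    (X : H →L[ℂ] H) : ℝ :=
  -(p / (2 * (p - 1))) * (kms σ (powerMap σ p.conjExponent p X) (L X)).re

/-- The `1`-Dirichlet form of a positive semidefinite `X`: with `Y = σ^{1/2} X σ^{1/2}` and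
`M = σ^{1/2} L(X) σ^{1/2}`, it is `-1/2 Tr[M (log Y - log σ)]`, where `log 0 = -∞`, that is,
`log Y` is the logarithm of `Y` on its support plus `-∞` times the projection onto `ker Y`, with
`∞ · 0 = 0`. In particular it is the usual trace when `X` is positive definite.
(`CFC.log` is the logarithm on the support, as `Real.log 0 = 0`.) -/
def oneDirichlet [FiniteDimensional ℂ H] (σ : H →L[ℂ] H)
    (L : (H →L[ℂ] H) →ₗ[ℂ] (H →L[ℂ] H)) (X : H →L[ℂ] H) : EReal :=
  let Y : H →L[ℂ] H := σ ^ (1 / 2 : ℝ) * X * σ ^ (1 / 2 : ℝ)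
  let M : H →L[ℂ] H := σ ^ (1 / 2 : ℝ) * L X * σ ^ (1 / 2 : ℝ)
  let Q : H →L[ℂ] H := (LinearMap.ker (Y : H →ₗ[ℂ] H)).starProjection
  ((-(1 / 2) * (tr (M * (CFC.log Y - CFC.log σ))).re : ℝ) : EReal)
    + ⊤ * (((1 / 2) * (tr (M * Q)).re : ℝ) : EReal)

open Classical in
/-- The `p`-Dirichlet form `E_{p,L}(X)` for `p ≥ 1` and `X` positive semidefinite, relative to the
reference state `σ`. It is finite for `p > 1`, and may be `+∞` for `p = 1`. -/
def pDirichlet [FiniteDimensional ℂ H] (σ : H →L[ℂ] H)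
    (L : (H →L[ℂ] H) →ₗ[ℂ] (H →L[ℂ] H)) (p : ℝ) (X : H →L[ℂ] H) : EReal :=
  if p = 1 then oneDirichlet σ L X else (pDirichletReal σ L p X : EReal)

end Dirichlet

section Predual

variable {H : Type*} [NormedAddCommGroup H] [InnerProductSpace ℂ H]
  [FiniteDimensional ℂ H]

/-- The defining property of the predual: `Tr[Φ(X) Y] = Tr[X Φ_*(Y)]`. -/
theorem tr_predual (Φ : (H →L[ℂ] H) →ₗ[ℂ] (H →L[ℂ] H)) (X Y : H →L[ℂ] H) :
    tr (Φ X * Y) = tr (X * predual Φ Y) := by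
  set b := stdOrthonormalBasis ℂ H with hb
  have hX : X = ∑ i, ∑ j, (inner ℂ (b i) (X (b j))) • InnerProductSpace.rankOne ℂ (b i) (b j) := by
    refine ContinuousLinearMap.coe_injective (b.toBasis.ext fun k => ?_)
    simp only [OrthonormalBasis.coe_toBasis, ContinuousLinearMap.coe_coe,
      sum_apply, smul_apply,
      InnerProductSpace.rankOne_apply, orthonormal_iff_ite.mp b.orthonormal]
    simp [b.sum_repr']
  have key : ∀ i j, tr (X * InnerProductSpace.rankOne ℂ (b j) (b i))
      = inner ℂ (b i) (X (b j)) := by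
    intro i j
    have : X * InnerProductSpace.rankOne ℂ (b j) (b i)
        = InnerProductSpace.rankOne ℂ (X (b j)) (b i) := by
      ext v
      simp [InnerProductSpace.rankOne_apply]
    rw [this, tr, InnerProductSpace.trace_rankOne]
  have hadd : ∀ f : Fin (Module.finrank ℂ H) → (H →L[ℂ] H),
      tr (∑ i, f i) = ∑ i, tr (f i) := by
    intro f
    simp [tr, ContinuousLinearMap.toLinearMap_sum]
  have hsmul : ∀ (c : ℂ) (Z : H →L[ℂ] H), tr (c • Z) = c * tr Z := by
    intro c Z
    simp [tr]
  unfold predual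
  rw [← hb]
  conv_lhs => rw [hX]
  simp only [map_sum, map_smul, Finset.sum_mul, Finset.mul_sum, hadd, smul_mul_assoc,
    mul_smul_comm, hsmul, key]
  exact Finset.sum_congr rfl fun i _ => Finset.sum_congr rfl fun j _ => mul_comm _ _

end Predual

end QMS

end

/-!
Write `σ` for the reference state and `Y = σ ^ (1 / 2p) X σ ^ (1 / 2p)`. For fixed `X` both sides
of the inequality are expressions in one and the same classical jump process, for which the
inequality reduces to one between numbers.

Let `σ` have eigenvectors `e` with eigenvalues `s`, and let `f` be an eigenbasis of `Y`. For a
linear map `Φ` on `B(H)`, `rate` attaches to each pair `k, l` a signed measure on the set of the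
modular ratios `s a / s c`, whose total mass is `⟨f k, Φ(|f l⟩⟨f l|) f k⟩`. Symmetry for the scalar
product `Tr[σ X^* Y]` does two things: it forces `Φ` to commute with the modular group
(`ratio_eq_of_coef_ne_zero`), so that all the powers of `σ` in the Dirichlet forms become functions
of the ratio `ω`, and it gives the detailed balance `W k l (g) = W l k (ω g(1/ω))` (`rate_symm`).
Complete positivity makes the measures of `P_t` positive (`rate_nonneg_of_completelyPositive`);
since the identity map contributes to the diagonal at `ω = 1` only (`rate_id`), the measures of the
generator are positive everywhere else, and `L(1) = 0` is conservation of mass. These facts form the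
notion `IsRateFamily`.

With `μ k` the eigenvalues of `Y ^ p`, the Dirichlet forms are, up to constant factors, integrals of
homogeneous functions of the pairs `(μ k, ω μ l)`: `x ^ (1 - 1/p) y ^ (1/p)` for `p > 1`, `√x √y`
for `p = 2`, and `y (log y - log x)` for `p = 1`. Detailed balance and conservation of mass turn
them into integrals of `(x ^ (1 - 1/p) - y ^ (1 - 1/p)) (x ^ (1/p) - y ^ (1/p))`, `(√x - √y)²` and
`(x - y) (log x - log y)`, which vanish on the diagonal, and the theorem follows from the scalar
Stroock–Varopoulos inequalities `stroock_varopoulos` and `sub_sqrt_sq_le_sub_mul_log`. For `p = 1`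
and `Y` with a kernel, the coefficient of `+∞` is the mass between the kernel and its complement; it
is nonnegative, and if it vanishes then the two do not interact and the kernel can be left out
(`IsRateFamily.le_sum_log`).

It remains to see that the objects named in the statement are the intended ones. The generator
exists because a continuous semigroup in a Banach algebra is differentiable
(`exists_tendsto_semigroup_slope`). The limit points of `P_t` as `t → ∞` form a compact semigroup,
which contains an idempotent; by the equality case of the Schwarz inequality this idempotent is a
conditional expectation onto the decoherence-free algebra (`exists_isDFExpectation`). It is
faithful, because it is compatible with a faithful invariant state, and so `σ_Tr` is positive
definite (`isStrictlyPositive_sigmaTr`).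
-/

noncomputable section

namespace QMS

/-! ### Scalar inequalities -/

theorem sinh_mul_le {t v : ℝ} (ht0 : 0 ≤ t) (ht1 : t ≤ 1) (hv : 0 ≤ v) :
    Real.sinh (t * v) ≤ t * Real.sinh v := by
  have hc : ConvexOn ℝ (Set.Ici 0) Real.sinh := by
    refine MonotoneOn.convexOn_of_deriv (convex_Ici 0) Real.continuous_sinh.continuousOn
      Real.differentiable_sinh.differentiableOn ?_
    rw [Real.deriv_sinh, interior_Ici]
    intro x hx y hy hxy
    exact Real.cosh_le_cosh.2 (by rwa [abs_of_pos hx, abs_of_pos hy])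
  have := hc.2 (Set.mem_Ici.2 le_rfl) (Set.mem_Ici.2 hv) (sub_nonneg.2 ht1) ht0 (by ring)
  simpa using this

theorem sinh_le_mul_cosh {v : ℝ} (hv : 0 ≤ v) : Real.sinh v ≤ v * Real.cosh v := by
  have hm : MonotoneOn (fun v => v * Real.cosh v - Real.sinh v) (Set.Ici 0) := by
    refine monotoneOn_of_deriv_nonneg (convex_Ici 0) (by fun_prop) (by fun_prop) ?_
    intro x hx
    rw [interior_Ici] at hx
    have : HasDerivAt (fun v => v * Real.cosh v - Real.sinh v)
        (1 * Real.cosh x + x * Real.sinh x - Real.cosh x) x :=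
      ((hasDerivAt_id x).mul (Real.hasDerivAt_cosh x)).sub (Real.hasDerivAt_sinh x)
    rw [this.deriv]
    have := mul_nonneg (le_of_lt hx) (Real.sinh_nonneg_iff.2 (le_of_lt hx))
    linarith
  have := hm (Set.mem_Ici.2 le_rfl) (Set.mem_Ici.2 hv) hv
  simp at this
  linarith

/-- Hyperbolic coordinates on the pairs `0 < y ≤ x`. -/
theorem exists_exp_coordinates {x y : ℝ} (hy : 0 < y) (hxy : y ≤ x) :
    ∃ m v : ℝ, 0 ≤ v ∧ x = Real.exp (m + 2 * v) ∧ y = Real.exp (m - 2 * v) ∧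
      (x ^ (1 / 2 : ℝ) - y ^ (1 / 2 : ℝ)) ^ 2 = 4 * Real.exp m * Real.sinh v ^ 2 := by
  have hx : 0 < x := hy.trans_le hxy
  obtain ⟨m, v, hv, hX, hY⟩ : ∃ m v : ℝ, 0 ≤ v ∧ x = Real.exp (m + 2 * v) ∧
      y = Real.exp (m - 2 * v) := by
    refine ⟨(Real.log x + Real.log y) / 2, (Real.log x - Real.log y) / 4, ?_, ?_, ?_⟩
    · have := Real.log_le_log hy hxy
      linarith
    · rw [show (Real.log x + Real.log y) / 2 + 2 * ((Real.log x - Real.log y) / 4) = Real.log x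
        by ring, Real.exp_log hx]
    · rw [show (Real.log x + Real.log y) / 2 - 2 * ((Real.log x - Real.log y) / 4) = Real.log y
        by ring, Real.exp_log hy]
  have e1 : (x ^ (1 / 2 : ℝ) - y ^ (1 / 2 : ℝ)) ^ 2 = 4 * Real.exp m * Real.sinh v ^ 2 := by
    rw [hX, hY, ← Real.exp_mul, ← Real.exp_mul, Real.sinh_eq,
      show (m + 2 * v) * (1 / 2) = m / 2 + v by ring,
      show (m - 2 * v) * (1 / 2) = m / 2 + -v by ring, Real.exp_add, Real.exp_add]
    have : Real.exp m = Real.exp (m / 2) ^ 2 := by rw [← Real.exp_nat_mul]; congr 1; push_cast; ring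
    rw [this]; ring
  exact ⟨m, v, hv, hX, hY, e1⟩

/-- The scalar Stroock–Varopoulos inequality. -/
theorem stroock_varopoulos {z x y : ℝ} (hz0 : 0 < z) (hz1 : z < 1) (hx : 0 ≤ x) (hy : 0 ≤ y) :
    4 * z * (1 - z) * (x ^ (1 / 2 : ℝ) - y ^ (1 / 2 : ℝ)) ^ 2
      ≤ (x ^ (1 - z) - y ^ (1 - z)) * (x ^ z - y ^ z) := by
  have hsq : ∀ w : ℝ, 0 ≤ w → (w ^ (1 / 2 : ℝ)) ^ 2 = w := fun w hw => by
    rw [← Real.rpow_natCast, ← Real.rpow_mul hw]; norm_num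
  have hz : ∀ w : ℝ, 0 ≤ w → w ^ (1 - z) * w ^ z = w := fun w hw => by
    rw [← Real.rpow_add' hw (by norm_num)]; simp
  have h4 : 4 * z * (1 - z) ≤ 1 := by nlinarith [sq_nonneg (2 * z - 1)]
  rcases hx.eq_or_lt with rfl | hx
  · rw [Real.zero_rpow (by norm_num), Real.zero_rpow (by linarith), Real.zero_rpow hz0.ne']
    nlinarith [hsq y hy, hz y hy]
  rcases hy.eq_or_lt with rfl | hy
  · rw [Real.zero_rpow (by norm_num), Real.zero_rpow (by linarith), Real.zero_rpow hz0.ne']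
    nlinarith [hsq x hx.le, hz x hx.le]
  wlog hxy : y ≤ x generalizing x y
  · have := this hy.le hx.le hy hx (le_of_not_ge hxy)
    nlinarith
  -- In the variables `x = exp (m + 2 v)`, `y = exp (m - 2 v)`, `2 z = 1 + τ`, this is
  -- `sinh² (τ v) ≤ τ² sinh² v`.
  obtain ⟨m, v, hv, hX, hY, e1⟩ := exists_exp_coordinates hy hxy
  have key : Real.sinh ((2 * z - 1) * v) ^ 2 ≤ (2 * z - 1) ^ 2 * Real.sinh v ^ 2 := by
    have h1 := sinh_mul_le (abs_nonneg (2 * z - 1)) (abs_le.2 ⟨by linarith, by linarith⟩) hv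
    have h0 : 0 ≤ Real.sinh (|2 * z - 1| * v) :=
      Real.sinh_nonneg_iff.2 (mul_nonneg (abs_nonneg _) hv)
    have h2 : Real.sinh (|2 * z - 1| * v) ^ 2 = Real.sinh ((2 * z - 1) * v) ^ 2 := by
      rcases abs_choice (2 * z - 1) with h | h <;> rw [h]
      rw [neg_mul, Real.sinh_neg, neg_sq]
    calc _ = Real.sinh (|2 * z - 1| * v) ^ 2 := h2.symm
      _ ≤ (|2 * z - 1| * Real.sinh v) ^ 2 := pow_le_pow_left₀ h0 h1 2
      _ = _ := by rw [mul_pow, sq_abs]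
  have e2 : (x ^ (1 - z) - y ^ (1 - z)) * (x ^ z - y ^ z)
      = 4 * Real.exp m * (Real.sinh v ^ 2 - Real.sinh ((2 * z - 1) * v) ^ 2) := by
    have hp : (x ^ (1 - z) - y ^ (1 - z)) * (x ^ z - y ^ z)
        = x + y - x ^ (1 - z) * y ^ z - y ^ (1 - z) * x ^ z := by
      nlinarith [hz x hx.le, hz y hy.le]
    rw [hp, hX, hY, ← Real.exp_mul, ← Real.exp_mul, ← Real.exp_mul, ← Real.exp_mul,
      ← Real.exp_add, ← Real.exp_add, Real.sinh_eq, Real.sinh_eq,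
      show (m + 2 * v) * (1 - z) + (m - 2 * v) * z = m + -((2 * z - 1) * v) * 2 by ring,
      show (m - 2 * v) * (1 - z) + (m + 2 * v) * z = m + ((2 * z - 1) * v) * 2 by ring,
      show m + 2 * v = m + v * 2 by ring, show m - 2 * v = m + (-v) * 2 by ring,
      Real.exp_add, Real.exp_add, Real.exp_add, Real.exp_add]
    have hd : ∀ w : ℝ, Real.exp (w * 2) = Real.exp w ^ 2 := fun w => by
      rw [← Real.exp_nat_mul]; congr 1; push_cast; ring
    simp only [hd]
    have h1 : Real.exp v * Real.exp (-v) = 1 := by rw [← Real.exp_add]; simp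
    have h2 : Real.exp ((2 * z - 1) * v) * Real.exp (-((2 * z - 1) * v)) = 1 := by
      rw [← Real.exp_add]; simp
    linear_combination (2 * Real.exp m) * h1 - (2 * Real.exp m) * h2
  rw [e1, e2]
  have := mul_le_mul_of_nonneg_left key (Real.exp_pos m).le
  nlinarith

/-- The limiting case `z → 1` of the scalar Stroock–Varopoulos inequality. -/
theorem sub_sqrt_sq_le_sub_mul_log {x y : ℝ} (hx : 0 < x) (hy : 0 < y) :
    4 * (x ^ (1 / 2 : ℝ) - y ^ (1 / 2 : ℝ)) ^ 2
      ≤ (y - x) * (Real.log y - Real.log x) := by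
  wlog hxy : y ≤ x generalizing x y
  · have := this hy hx (le_of_not_ge hxy)
    nlinarith
  obtain ⟨m, v, hv, hX, hY, e1⟩ := exists_exp_coordinates hy hxy
  have e2 : (y - x) * (Real.log y - Real.log x)
      = 16 * Real.exp m * (Real.sinh v * (v * Real.cosh v)) := by
    rw [hX, hY, Real.log_exp, Real.log_exp, sub_eq_add_neg m, Real.exp_add, Real.exp_add,
      show Real.exp m * Real.exp (-(2 * v)) - Real.exp m * Real.exp (2 * v)
        = -(2 * Real.exp m * Real.sinh (2 * v)) by rw [Real.sinh_eq]; ring, Real.sinh_two_mul]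
    ring
  rw [e1, e2]
  have h0 := mul_le_mul_of_nonneg_left (sinh_le_mul_cosh hv) (Real.sinh_nonneg_iff.2 hv)
  have := mul_le_mul_of_nonneg_left h0 (Real.exp_pos m).le
  nlinarith

/-! ### Families of jump rates with detailed balance -/

/-- A family of jump rates: for each pair of labels `k, l` a signed measure `W k l` on the finite
set `R` of positive numbers, presented as a linear functional on functions `ℝ → ℝ`. The only mass
of negative sign that is allowed is at the point `1` of the diagonal, where it is the holding
rate. -/
structure IsRateFamily {ι : Type*} [Fintype ι] (R : Set ℝ) (W : ι → ι → (ℝ → ℝ) →ₗ[ℝ] ℝ) :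
    Prop where
  finite : R.Finite
  pos : ∀ ω ∈ R, 0 < ω
  one_mem : 1 ∈ R
  nonneg : ∀ k l g, (∀ ω ∈ R, 0 ≤ g ω) → (k = l → g 1 = 0) → 0 ≤ W k l g
  /-- Detailed balance. -/
  symm : ∀ k l g, W k l g = W l k fun ω => ω * g ω⁻¹
  /-- Conservation of mass. -/
  sum_one : ∀ k, ∑ l, W k l (fun _ => 1) = 0

/-- The sum over `k, l` of the integrals of `F (μ k) (ω * μ l)` against the rates `W k l`. -/
def pairSum {ι : Type*} [Fintype ι] (W : ι → ι → (ℝ → ℝ) →ₗ[ℝ] ℝ) (μ : ι → ℝ)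
    (F : ℝ → ℝ → ℝ) : ℝ :=
  ∑ k, ∑ l, W k l fun ω => F (μ k) (ω * μ l)

section PairSum

variable {ι : Type*} [Fintype ι] {R : Set ℝ} {W : ι → ι → (ℝ → ℝ) →ₗ[ℝ] ℝ} {μ : ι → ℝ}

theorem pairSum_add (F G : ℝ → ℝ → ℝ) :
    pairSum W μ (fun x y => F x y + G x y) = pairSum W μ F + pairSum W μ G := by
  simp only [pairSum, ← Finset.sum_add_distrib]
  refine Finset.sum_congr rfl fun k _ => Finset.sum_congr rfl fun l _ => ?_
  rw [← map_add]
  rfl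

theorem pairSum_const_mul (c : ℝ) (F : ℝ → ℝ → ℝ) :
    pairSum W μ (fun x y => c * F x y) = c * pairSum W μ F := by
  simp only [pairSum, Finset.mul_sum]
  refine Finset.sum_congr rfl fun k _ => Finset.sum_congr rfl fun l _ => ?_
  rw [← smul_eq_mul c, ← map_smul]
  rfl

namespace IsRateFamily

/-- The rates only see the values on `R`: they are positive on functions that vanish there, and
so are their negatives. -/
theorem congr (h : IsRateFamily R W) (k l : ι) {g g' : ℝ → ℝ} (hg : ∀ ω ∈ R, g ω = g' ω) :
    W k l g = W k l g' := by
  have h1 := h.nonneg k l (g - g') (fun ω hω => by simp [hg ω hω])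
    fun _ => by simp [hg 1 h.one_mem]
  have h2 := h.nonneg k l (g' - g) (fun ω hω => by simp [hg ω hω])
    fun _ => by simp [hg 1 h.one_mem]
  rw [map_sub] at h1 h2
  linarith

/-- Off the diagonal the rates are positive measures on `R`, and `ω` is bounded below there. -/
theorem eq_zero_of_apply_id_eq_zero (h : IsRateFamily R W) {k l : ι} (hkl : k ≠ l)
    (h0 : W k l (fun ω => ω) = 0) (g : ℝ → ℝ) : W k l g = 0 := by
  obtain ⟨C, hC⟩ : ∃ C, ∀ ω ∈ R, |g ω| / ω ≤ C := by
    obtain ⟨C, hC⟩ := (h.finite.image fun ω => |g ω| / ω).bddAbove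
    exact ⟨C, fun ω hω => hC ⟨ω, hω, rfl⟩⟩
  have hC' : ∀ ω ∈ R, |g ω| ≤ C * ω := fun ω hω => (div_le_iff₀ (h.pos ω hω)).1 (hC ω hω)
  have h1 := h.nonneg k l (C • (fun ω => ω) - g)
    (fun ω hω => by simpa using (le_abs_self _).trans (hC' ω hω)) fun e => absurd e hkl
  have h2 := h.nonneg k l (C • (fun ω => ω) + g)
    (fun ω hω => by
      have := neg_le_of_abs_le (hC' ω hω)
      simp only [Pi.add_apply, Pi.smul_apply, smul_eq_mul]
      linarith) fun e => absurd e hkl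
  rw [map_sub, map_smul, h0] at h1
  rw [map_add, map_smul, h0] at h2
  simp only [smul_zero] at h1 h2
  linarith

theorem pairSum_congr (h : IsRateFamily R W) {F G : ℝ → ℝ → ℝ}
    (hFG : ∀ k l, ∀ ω ∈ R, F (μ k) (ω * μ l) = G (μ k) (ω * μ l)) :
    pairSum W μ F = pairSum W μ G :=
  Finset.sum_congr rfl fun k _ => Finset.sum_congr rfl fun l _ => h.congr k l (hFG k l)

/-- Detailed balance: for a homogeneous `F` the two arguments may be exchanged. -/
theorem pairSum_swap (h : IsRateFamily R W) (hμ : ∀ k, 0 ≤ μ k) {F : ℝ → ℝ → ℝ}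
    (hF : ∀ c x y, 0 < c → 0 ≤ x → 0 ≤ y → F (c * x) (c * y) = c * F x y) :
    pairSum W μ F = pairSum W μ fun x y => F y x := by
  rw [pairSum, Finset.sum_comm]
  refine Finset.sum_congr rfl fun l _ => Finset.sum_congr rfl fun k _ => ?_
  rw [h.symm]
  refine h.congr l k fun ω hω => ?_
  have hω := h.pos ω hω
  rw [← hF ω _ _ hω (hμ k) (by have := hμ l; positivity), mul_inv_cancel_left₀ hω.ne']

/-- Conservation of mass, integrated. -/
theorem pairSum_of_fst (h : IsRateFamily R W) (f : ℝ → ℝ) :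
    pairSum W μ (fun x _ => f x) = 0 := by
  refine Finset.sum_eq_zero fun k _ => ?_
  have : ∀ l, W k l (fun _ => f (μ k)) = f (μ k) * W k l fun _ => 1 := fun l => by
    rw [← smul_eq_mul, ← map_smul]
    congr 1
    ext
    simp
  simp only [this, ← Finset.mul_sum, h.sum_one, mul_zero]

theorem pairSum_snd (h : IsRateFamily R W) (hμ : ∀ k, 0 ≤ μ k) :
    pairSum W μ (fun _ y => y) = 0 := by
  rw [h.pairSum_swap hμ fun _ _ _ _ _ _ => rfl, h.pairSum_of_fst fun x => x]

/-- The column sums `∑ k, ∫ ω dW k l` vanish: this is invariance of the reference state. -/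
theorem sum_apply_id (h : IsRateFamily R W) (l : ι) : ∑ k, W k l (fun ω => ω) = 0 := by
  rw [← h.sum_one l]
  refine Finset.sum_congr rfl fun k _ => ?_
  rw [h.symm k l]
  exact h.congr l k fun ω hω => mul_inv_cancel₀ (h.pos ω hω).ne'

/-- The holding rates do not matter for functions that vanish on the diagonal. -/
theorem pairSum_nonneg (h : IsRateFamily R W) (hμ : ∀ k, 0 ≤ μ k) {F : ℝ → ℝ → ℝ}
    (hF : ∀ x y, 0 ≤ x → 0 ≤ y → 0 ≤ F x y) (hF' : ∀ x, 0 ≤ x → F x x = 0) :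
    0 ≤ pairSum W μ F := by
  refine Finset.sum_nonneg fun k _ => Finset.sum_nonneg fun l _ => h.nonneg k l _ ?_ ?_
  · exact fun ω hω => hF _ _ (hμ k) (mul_nonneg (h.pos ω hω).le (hμ l))
  · rintro rfl
    rw [one_mul]
    exact hF' _ (hμ k)

theorem pairSum_sq (h : IsRateFamily R W) (hμ : ∀ k, 0 ≤ μ k) :
    pairSum W μ (fun x y => (x ^ (1 / 2 : ℝ) - y ^ (1 / 2 : ℝ)) ^ 2)
      = -2 * pairSum W μ (fun x y => x ^ (1 / 2 : ℝ) * y ^ (1 / 2 : ℝ)) := by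
  have hsq : ∀ w : ℝ, 0 ≤ w → (w ^ (1 / 2 : ℝ)) ^ 2 = w := fun w hw => by
    rw [← Real.rpow_natCast, ← Real.rpow_mul hw]; norm_num
  rw [h.pairSum_congr (G := fun x y => (x + y) + (-2) * (x ^ (1 / 2 : ℝ) * y ^ (1 / 2 : ℝ))),
    pairSum_add, pairSum_add, pairSum_const_mul, h.pairSum_of_fst fun x => x, h.pairSum_snd hμ]
  · ring
  · intro k l ω hω
    have h1 := hsq _ (hμ k)
    have h2 := hsq _ (mul_nonneg (h.pos ω hω).le (hμ l))
    linear_combination h1 + h2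

/-- The Stroock–Varopoulos inequality for a family of jump rates. -/
theorem pairSum_rpow_le (h : IsRateFamily R W) (hμ : ∀ k, 0 ≤ μ k) {z : ℝ} (hz0 : 0 < z)
    (hz1 : z < 1) :
    pairSum W μ (fun x y => x ^ (1 - z) * y ^ z)
      ≤ 4 * z * (1 - z) * pairSum W μ (fun x y => x ^ (1 / 2 : ℝ) * y ^ (1 / 2 : ℝ)) := by
  have hz : ∀ w : ℝ, 0 ≤ w → w ^ (1 - z) * w ^ z = w := fun w hw => by
    rw [← Real.rpow_add' hw (by norm_num)]; simp
  have hsw : pairSum W μ (fun x y => x ^ (1 - z) * y ^ z)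
      = pairSum W μ (fun x y => y ^ (1 - z) * x ^ z) := by
    refine h.pairSum_swap hμ fun c x y hc hx hy => ?_
    rw [Real.mul_rpow hc.le hx, Real.mul_rpow hc.le hy]
    linear_combination (x ^ (1 - z) * y ^ z) * hz c hc.le
  have hprod : pairSum W μ (fun x y => (x ^ (1 - z) - y ^ (1 - z)) * (x ^ z - y ^ z))
      = -2 * pairSum W μ (fun x y => x ^ (1 - z) * y ^ z) := by
    rw [h.pairSum_congr (G := fun x y => ((x + y) + (-1) * (x ^ (1 - z) * y ^ z))
        + (-1) * (y ^ (1 - z) * x ^ z)), pairSum_add, pairSum_add, pairSum_add, pairSum_const_mul,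
      pairSum_const_mul, h.pairSum_of_fst fun x => x, h.pairSum_snd hμ, ← hsw]
    · ring
    · intro k l ω hω
      linear_combination hz _ (hμ k) + hz _ (mul_nonneg (h.pos ω hω).le (hμ l))
  have := h.pairSum_nonneg hμ (F := fun x y => (x ^ (1 - z) - y ^ (1 - z)) * (x ^ z - y ^ z)
      + (-(4 * z * (1 - z))) * (x ^ (1 / 2 : ℝ) - y ^ (1 / 2 : ℝ)) ^ 2)
    (fun x y hx hy => by linarith [stroock_varopoulos hz0 hz1 hx hy]) (fun x _ => by ring)
  rw [pairSum_add, pairSum_const_mul, hprod, h.pairSum_sq hμ] at this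
  linarith

theorem ker_term_nonneg (h : IsRateFamily R W) (hμ : ∀ k, 0 ≤ μ k) (k l : ι) :
    0 ≤ (if μ k = 0 then 1 else 0) * μ l * W k l (fun ω => ω) := by
  split_ifs with hk
  · by_cases hkl : k = l
    · simp [← hkl, hk]
    · have := h.nonneg k l (fun ω => ω) (fun ω hω => (h.pos ω hω).le) fun e => absurd e hkl
      have := hμ l
      positivity
  · simp

/-- The mass that the rates `W k l`, weighted by `μ l` and `ω`, connect to the zero set of `μ` is
nonnegative. It is the coefficient of `+∞` in the `1`-Dirichlet form. -/
theorem sum_ker_nonneg (h : IsRateFamily R W) (hμ : ∀ k, 0 ≤ μ k) :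
    0 ≤ ∑ k, ∑ l, (if μ k = 0 then 1 else 0) * μ l * W k l (fun ω => ω) :=
  Finset.sum_nonneg fun k _ => Finset.sum_nonneg fun l _ => h.ker_term_nonneg hμ k l

/-- If that mass vanishes, then there are no rates at all between the zero set of `μ` and its
complement. -/
theorem apply_eq_zero_of_sum_ker_eq_zero (h : IsRateFamily R W) (hμ : ∀ k, 0 ≤ μ k)
    (h0 : ∑ k, ∑ l, (if μ k = 0 then 1 else 0) * μ l * W k l (fun ω => ω) = 0) {k l : ι}
    (hk : μ k = 0) (hl : μ l ≠ 0) (g : ℝ → ℝ) : W k l g = 0 ∧ W l k g = 0 := by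
  have hkl : k ≠ l := by rintro rfl; exact hl hk
  have h1 := (Finset.sum_eq_zero_iff_of_nonneg
    fun k _ => Finset.sum_nonneg fun l _ => h.ker_term_nonneg hμ k l).1 h0 k (Finset.mem_univ k)
  have h2 := (Finset.sum_eq_zero_iff_of_nonneg fun l _ => h.ker_term_nonneg hμ k l).1 h1 l
    (Finset.mem_univ l)
  have h3 : W k l (fun ω => ω) = 0 := by simpa [hk, hl] using h2
  refine ⟨h.eq_zero_of_apply_id_eq_zero hkl h3 g, ?_⟩
  rw [h.symm]
  exact h.eq_zero_of_apply_id_eq_zero hkl h3 _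

/-- The logarithmic Stroock–Varopoulos inequality for a family of jump rates. The hypothesis says
that the zero set of `μ` is not connected to its complement; otherwise `Real.log 0 = 0` would make
the right-hand side differ from the entropy production it stands for, which is `+∞`. -/
theorem le_sum_log (h : IsRateFamily R W) (hμ : ∀ k, 0 ≤ μ k)
    (h0 : ∑ k, ∑ l, (if μ k = 0 then 1 else 0) * μ l * W k l (fun ω => ω) = 0) :
    -4 * pairSum W μ (fun x y => x ^ (1 / 2 : ℝ) * y ^ (1 / 2 : ℝ))
      ≤ ∑ k, ∑ l, (μ l * W k l (fun ω => ω * Real.log ω)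
          - Real.log (μ k) * μ l * W k l (fun ω => ω)) := by
  have hvan := fun k l => h.apply_eq_zero_of_sum_ker_eq_zero hμ h0 (k := k) (l := l)
  set F : ℝ → ℝ → ℝ := fun x y => if x = 0 ∨ y = 0 then 0 else y * (Real.log y - Real.log x)
    with hF
  set G : ℝ → ℝ → ℝ := fun x y =>
    if x = 0 ∨ y = 0 then 0 else (x ^ (1 / 2 : ℝ) - y ^ (1 / 2 : ℝ)) ^ 2 with hG
  have hlog : ∑ k, ∑ l, (μ l * W k l (fun ω => ω * Real.log ω)
      - Real.log (μ k) * μ l * W k l (fun ω => ω)) = pairSum W μ F := by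
    have hz : ∑ k, ∑ l, μ l * Real.log (μ l) * W k l (fun ω => ω) = 0 := by
      rw [Finset.sum_comm]
      refine Finset.sum_eq_zero fun l _ => ?_
      rw [← Finset.mul_sum, h.sum_apply_id, mul_zero]
    rw [← add_zero (∑ k, _), ← hz]
    simp only [pairSum, ← Finset.sum_add_distrib]
    refine Finset.sum_congr rfl fun k _ => Finset.sum_congr rfl fun l _ => ?_
    have hcomb : ∀ a b c : ℝ, a * W k l (fun ω => ω * Real.log ω) - b * a * W k l (fun ω => ω)
        + c * W k l (fun ω => ω)
        = W k l (fun ω => a * (ω * Real.log ω) - b * a * ω + c * ω) := by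
      intro a b c
      simp only [← smul_eq_mul (a := a) (b := W k l _), ← smul_eq_mul (a := b * a) (b := W k l _),
        ← smul_eq_mul (a := c) (b := W k l _), ← map_smul, ← map_sub, ← map_add]
      rfl
    rw [hcomb]
    by_cases hl : μ l = 0
    · simp [hF, hl]
    by_cases hk : μ k = 0
    · rw [(hvan k l hk hl _).1, (hvan k l hk hl _).1]
    refine h.congr k l fun ω hω => ?_
    have hω := h.pos ω hω
    simp only [hF, hk, hl, mul_eq_zero, hω.ne', or_self, if_false]
    rw [Real.log_mul hω.ne' hl]
    ring
  have hGsum : pairSum W μ G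
      = -2 * pairSum W μ (fun x y => x ^ (1 / 2 : ℝ) * y ^ (1 / 2 : ℝ)) := by
    rw [← h.pairSum_sq hμ]
    refine Finset.sum_congr rfl fun k _ => Finset.sum_congr rfl fun l _ => ?_
    by_cases hk : μ k = 0 <;> by_cases hl : μ l = 0
    · simp [hG, hk, hl]
    · rw [(hvan k l hk hl _).1, (hvan k l hk hl _).1]
    · rw [(hvan l k hl hk _).2, (hvan l k hl hk _).2]
    · refine h.congr k l fun ω hω => ?_
      have hω := h.pos ω hω
      simp only [hG, hk, hl, mul_eq_zero, hω.ne', or_self, if_false]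
  have hsw : pairSum W μ F = pairSum W μ fun x y => F y x := by
    refine h.pairSum_swap hμ fun c x y hc _ _ => ?_
    simp only [hF, mul_eq_zero, hc.ne', false_or]
    split_ifs with hxy
    · simp
    · rw [not_or] at hxy
      rw [Real.log_mul hc.ne' hxy.1, Real.log_mul hc.ne' hxy.2]
      ring
  have := h.pairSum_nonneg hμ (F := fun x y => (F x y + F y x) + (-4) * G x y)
    (fun x y hx hy => by
      by_cases hxy : x = 0 ∨ y = 0
      · simp [hF, hG, hxy, hxy.symm]
      · have hyx : ¬(y = 0 ∨ x = 0) := fun e => hxy e.symm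
        simp only [hF, hG, if_neg hxy, if_neg hyx]
        rw [not_or] at hxy
        have := sub_sqrt_sq_le_sub_mul_log (lt_of_le_of_ne hx (Ne.symm hxy.1))
          (lt_of_le_of_ne hy (Ne.symm hxy.2))
        linarith)
    (fun x _ => by simp [hF, hG])
  rw [pairSum_add, pairSum_add, pairSum_const_mul, ← hsw, hGsum] at this
  rw [hlog]
  linarith

end IsRateFamily

end PairSum

/-! ### Operators on a finite-dimensional Hilbert space -/

section Operators

variable {H : Type*} [NormedAddCommGroup H] [InnerProductSpace ℂ H]
  {ι : Type*} [Fintype ι] {f : OrthonormalBasis ι ℂ H} {σ D : H →L[ℂ] H}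

theorem aeval_apply_of_apply_eq {A : H →L[ℂ] H} {v : H} {r : ℝ} (hv : A v = (r : ℂ) • v)
    (q : Polynomial ℝ) : Polynomial.aeval A q v = ((q.eval r : ℝ) : ℂ) • v := by
  induction q using Polynomial.induction_on' with
  | add p q hp hq => simp [hp, hq, add_smul]
  | monomial n a =>
    have : ∀ n : ℕ, (A ^ n) v = ((r ^ n : ℝ) : ℂ) • v := by
      intro n
      induction n with
      | zero => simp
      | succ n ih =>
        rw [pow_succ', mul_apply_eq_comp, ih, map_smul, hv, smul_smul]
        push_cast
        ring_nf
    simp [Polynomial.aeval_monomial, this, Algebra.algebraMap_eq_smul_one, mul_smul]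

theorem ext_basis (b : OrthonormalBasis ι ℂ H) {A B : H →L[ℂ] H} (h : ∀ i, A (b i) = B (b i)) :
    A = B :=
  ContinuousLinearMap.coe_injective (b.toBasis.ext fun k => by simpa using h k)

theorem tr_eq_sum (b : OrthonormalBasis ι ℂ H) (X : H →L[ℂ] H) :
    tr X = ∑ i, inner ℂ (b i) (X (b i)) :=
  LinearMap.trace_eq_sum_inner (X : H →ₗ[ℂ] H) b

theorem tr_mul_comm (X Y : H →L[ℂ] H) : tr (X * Y) = tr (Y * X) :=
  LinearMap.trace_mul_comm ℂ (X : H →ₗ[ℂ] H) (Y : H →ₗ[ℂ] H)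

/-- The trace, as a linear functional. -/
def trₗ : (H →L[ℂ] H) →ₗ[ℂ] ℂ :=
  LinearMap.trace ℂ H ∘ₗ ContinuousLinearMap.coeLM ℂ

theorem tr_sub (X Y : H →L[ℂ] H) : tr (X - Y) = tr X - tr Y := trₗ.map_sub X Y
theorem tr_smul (c : ℂ) (X : H →L[ℂ] H) : tr (c • X) = c * tr X := trₗ.map_smul c X

open InnerProductSpace in
theorem eq_sum_rankOne (b : OrthonormalBasis ι ℂ H) (X : H →L[ℂ] H) :
    X = ∑ c, ∑ d, inner ℂ (b c) (X (b d)) • rankOne ℂ (b c) (b d) := by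
  classical
  refine ext_basis b fun k => ?_
  simp only [sum_apply, smul_apply, rankOne_apply, orthonormal_iff_ite.mp b.orthonormal]
  simp [b.sum_repr']

/-- The matrix elements `⟨e a, Φ(|e c⟩⟨e d|) e b⟩` of a linear map on `B(H)`. -/
def coef (e : OrthonormalBasis ι ℂ H) (Φ : (H →L[ℂ] H) →ₗ[ℂ] (H →L[ℂ] H)) (a b c d : ι) : ℂ :=
  inner ℂ (e a) (Φ (InnerProductSpace.rankOne ℂ (e c) (e d)) (e b))

theorem tr_mul_eq_sum {ι : Type*} [Fintype ι] {f : OrthonormalBasis ι ℂ H} {m : ι → ℝ}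
    (hf : ∀ k, D (f k) = (m k : ℂ) • f k) (σ : H →L[ℂ] H) :
    (tr (σ * D)).re = ∑ k, m k * (inner ℂ (f k) (σ (f k))).re := by
  rw [tr_eq_sum f, Complex.re_sum]
  refine Finset.sum_congr rfl fun k _ => ?_
  rw [mul_apply_eq_comp, hf, map_smul, inner_smul_right, Complex.re_ofReal_mul]

theorem re_inner_nonneg (hσ : 0 ≤ σ) (v : H) : 0 ≤ (inner ℂ v (σ v)).re :=
  (ContinuousLinearMap.nonneg_iff_isPositive σ).1 hσ |>.re_inner_nonneg_right v

section FiniteDimensional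

variable [FiniteDimensional ℂ H]

/-- The spectral theorem for a positive semidefinite operator. -/
theorem exists_eigenbasis {A : H →L[ℂ] H} (hA : 0 ≤ A) :
    ∃ (b : OrthonormalBasis (Fin (Module.finrank ℂ H)) ℂ H)
      (r : Fin (Module.finrank ℂ H) → ℝ), (∀ i, 0 ≤ r i) ∧ ∀ i, A (b i) = (r i : ℂ) • b i := by
  rw [ContinuousLinearMap.nonneg_iff_isPositive] at hA
  have hs : (A : H →ₗ[ℂ] H).IsSymmetric := hA.isSymmetric
  have happ : ∀ i, A (hs.eigenvectorBasis rfl i)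
      = ((hs.eigenvalues rfl i : ℝ) : ℂ) • hs.eigenvectorBasis rfl i :=
    fun i => hs.apply_eigenvectorBasis rfl i
  refine ⟨hs.eigenvectorBasis rfl, hs.eigenvalues rfl, fun i => ?_, happ⟩
  have := hA.re_inner_nonneg_right (hs.eigenvectorBasis rfl i)
  rw [happ, inner_smul_right, inner_self_eq_norm_sq_to_K] at this
  simpa using this

theorem re_tr_mul_nonneg (hσ : 0 ≤ σ) (hD : 0 ≤ D) : 0 ≤ (tr (σ * D)).re := by
  obtain ⟨f, m, hm, hf⟩ := exists_eigenbasis hD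
  rw [tr_mul_eq_sum hf]
  exact Finset.sum_nonneg fun k _ => mul_nonneg (hm k) (re_inner_nonneg hσ _)

open InnerProductSpace in
theorem tr_mul_rankOne (X : H →L[ℂ] H) (x y : H) :
    tr (X * rankOne ℂ x y) = inner ℂ y (X x) := by
  have : X * rankOne ℂ x y = rankOne ℂ (X x) y := by
    ext v
    simp [rankOne_apply]
  rw [this, tr, trace_rankOne]

theorem continuous_tr : Continuous (tr : (H →L[ℂ] H) → ℂ) :=
  (trₗ : (H →L[ℂ] H) →ₗ[ℂ] ℂ).continuous_of_finiteDimensional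

end FiniteDimensional

variable [CompleteSpace H]

/-- The functional calculus in an eigenbasis. On the finite spectrum every function is a
polynomial. -/
theorem cfc_apply_basis {A : H →L[ℂ] H} (hA : IsSelfAdjoint A) {b : OrthonormalBasis ι ℂ H}
    {r : ι → ℝ} (hb : ∀ i, A (b i) = (r i : ℂ) • b i) (g : ℝ → ℝ) (i : ι) :
    cfc g A (b i) = (g (r i) : ℂ) • b i := by
  classical
  have : Nontrivial H := ⟨b i, 0, b.toBasis.ne_zero i⟩
  have hspec : spectrum ℝ A ⊆ Set.range r := by
    intro x hx
    set q : Polynomial ℝ := ∏ j, (Polynomial.X - Polynomial.C (r j))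
    have hq : Polynomial.aeval A q = 0 := ext_basis b fun j => by
      rw [aeval_apply_of_apply_eq (hb j), Polynomial.eval_prod,
        Finset.prod_eq_zero (Finset.mem_univ j) (by simp)]
      simp
    have := spectrum.subset_polynomial_aeval A q ⟨x, hx, rfl⟩
    rw [hq, spectrum.zero_eq, Set.mem_singleton_iff] at this
    simp only [q, Polynomial.eval_prod, Finset.prod_eq_zero_iff, Polynomial.eval_sub,
      Polynomial.eval_X, Polynomial.eval_C, sub_eq_zero] at this
    obtain ⟨j, -, hj⟩ := this
    exact ⟨j, hj.symm⟩
  set q := Lagrange.interpolate (Finset.univ.image r) id g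
  have hq : ∀ j, q.eval (r j) = g (r j) := fun j =>
    Lagrange.eval_interpolate_at_node g (Set.injOn_id _)
      (Finset.mem_image_of_mem r (Finset.mem_univ j))
  have hcfc : cfc g A = cfc q.eval A := cfc_congr fun x hx => by
    obtain ⟨j, rfl⟩ := hspec hx
    exact (hq j).symm
  rw [hcfc, cfc_polynomial q A hA, aeval_apply_of_apply_eq (hb i), hq]

theorem rpow_apply_basis {A : H →L[ℂ] H} (hA : 0 ≤ A) {b : OrthonormalBasis ι ℂ H}
    {r : ι → ℝ} (hb : ∀ i, A (b i) = (r i : ℂ) • b i) (y : ℝ) (i : ι) :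
    (A ^ y) (b i) = ((r i ^ y : ℝ) : ℂ) • b i := by
  rw [CFC.rpow_eq_cfc_real hA]
  exact cfc_apply_basis hA.isSelfAdjoint hb _ i

theorem isSelfAdjoint_rpow (A : H →L[ℂ] H) (u : ℝ) : IsSelfAdjoint (A ^ u) :=
  (CFC.rpow_nonneg (a := A) (y := u)).isSelfAdjoint

theorem rpow_sandwich (hσ : IsStrictlyPositive σ) (u : ℝ) (X : H →L[ℂ] H) :
    σ ^ (-u) * (σ ^ u * X * σ ^ u) * σ ^ (-u) = X := by
  have h1 := CFC.rpow_neg_mul_rpow u hσ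
  have h2 := CFC.rpow_mul_rpow_neg u hσ
  calc _ = (σ ^ (-u) * σ ^ u) * X * (σ ^ u * σ ^ (-u)) := by simp only [mul_assoc]
    _ = X := by rw [h1, h2, one_mul, mul_one]

theorem sandwich_powerMap (hσ : IsStrictlyPositive σ) {r p : ℝ} {X : H →L[ℂ] H}
    (hX : 0 ≤ σ ^ (1 / (2 * p)) * X * σ ^ (1 / (2 * p))) :
    σ ^ (1 / (2 * r)) * powerMap σ r p X * σ ^ (1 / (2 * r))
      = (σ ^ (1 / (2 * p)) * X * σ ^ (1 / (2 * p))) ^ (p / r) := by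
  have := rpow_sandwich hσ (-(1 / (2 * r))) ((σ ^ (1 / (2 * p)) * X * σ ^ (1 / (2 * p))) ^ (p / r))
  rw [powerMap, CFC.abs_of_nonneg _ hX]
  rwa [neg_neg] at this

theorem inner_apply_basis {b : OrthonormalBasis ι ℂ H} {A : H →L[ℂ] H} (hA : IsSelfAdjoint A)
    {r : ι → ℝ} (hb : ∀ i, A (b i) = (r i : ℂ) • b i) (i : ι) (v : H) :
    inner ℂ (b i) (A v) = r i * inner ℂ (b i) v := by
  rw [← ContinuousLinearMap.adjoint_inner_left, hA.adjoint_eq, hb, inner_smul_left]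
  simp

theorem starProjection_ker_apply {Y : H →L[ℂ] H} (hY : IsSelfAdjoint Y) {m : ι → ℝ}
    (hf : ∀ k, Y (f k) = (m k : ℂ) • f k) (k : ι) :
    (LinearMap.ker (Y : H →ₗ[ℂ] H)).starProjection (f k)
      = (((if m k = 0 then 1 else 0 : ℝ)) : ℂ) • f k := by
  split_ifs with h
  · rw [Complex.ofReal_one, one_smul, Submodule.starProjection_eq_self_iff, LinearMap.mem_ker]
    simpa [h] using hf k
  · rw [Complex.ofReal_zero, zero_smul, Submodule.starProjection_apply_eq_zero_iff,
      Submodule.mem_orthogonal]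
    intro w hw
    have hw : Y w = 0 := hw
    have h1 : inner ℂ w (Y (f k)) = 0 := by
      rw [← ContinuousLinearMap.adjoint_inner_left, hY.adjoint_eq, hw, inner_zero_left]
    rw [hf, inner_smul_right] at h1
    exact (mul_eq_zero.1 h1).resolve_left (by exact_mod_cast h)

/-- Expansion of `Tr[S K S Φ(T N T)]` in a basis that diagonalizes `S` and `T`. -/
theorem tr_sandwich (e : OrthonormalBasis ι ℂ H) (Φ : (H →L[ℂ] H) →ₗ[ℂ] (H →L[ℂ] H))
    {S T : H →L[ℂ] H} (hS : IsSelfAdjoint S) (hT : IsSelfAdjoint T) {u v : ι → ℝ}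
    (hu : ∀ i, S (e i) = (u i : ℂ) • e i) (hv : ∀ i, T (e i) = (v i : ℂ) • e i)
    (K N : H →L[ℂ] H) :
    tr (S * K * S * Φ (T * N * T))
      = ∑ a, ∑ b, ∑ c, ∑ d, ((u a * u b * (v c * v d) : ℝ) : ℂ)
          * (inner ℂ (e b) (K (e a)) * inner ℂ (e c) (N (e d))) * coef e Φ a b c d := by
  have hN : T * N * T = ∑ c, ∑ d, ((v c * v d : ℝ) * inner ℂ (e c) (N (e d)))
      • InnerProductSpace.rankOne ℂ (e c) (e d) := by
    conv_lhs => rw [eq_sum_rankOne e (T * N * T)]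
    refine Finset.sum_congr rfl fun c _ => Finset.sum_congr rfl fun d _ => ?_
    congr 1
    simp only [mul_apply_eq_comp, inner_apply_basis hT hv, hv, map_smul,
      inner_smul_right]
    push_cast
    ring
  have hK : ∀ Z : H →L[ℂ] H, tr (S * K * S * Z) = ∑ a, ∑ b,
      ((u a * u b : ℝ) : ℂ) * inner ℂ (e b) (K (e a)) * inner ℂ (e a) (Z (e b)) := by
    intro Z
    rw [tr_eq_sum e, Finset.sum_comm]
    refine Finset.sum_congr rfl fun b _ => ?_
    simp only [mul_apply_eq_comp, inner_apply_basis hS hu]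
    conv_lhs => rw [← e.sum_repr' (S (Z (e b)))]
    simp only [map_sum, map_smul, inner_sum, inner_smul_right, inner_apply_basis hS hu,
      Finset.mul_sum]
    refine Finset.sum_congr rfl fun a _ => ?_
    push_cast
    ring
  rw [hN, hK]
  refine Finset.sum_congr rfl fun a _ => Finset.sum_congr rfl fun b _ => ?_
  simp only [map_sum, map_smul, sum_apply, smul_apply, inner_sum, inner_smul_right,
    Finset.mul_sum]
  refine Finset.sum_congr rfl fun c _ => Finset.sum_congr rfl fun d _ => ?_
  simp only [coef]
  push_cast
  ring

theorem re_inner_pos_of_isStrictlyPositive (hσ : IsStrictlyPositive σ) {v : H} (hv : v ≠ 0) :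
    0 < (inner ℂ v (σ v)).re := by
  set S := σ ^ (1 / 2 : ℝ) with hS
  have hSS : S * S = σ := by
    rw [hS, ← CFC.rpow_add hσ.isUnit]
    norm_num
    exact CFC.rpow_one σ hσ.nonneg
  have hne : S v ≠ 0 := by
    intro h0
    obtain ⟨τ, hτ⟩ := hσ.isUnit.exists_left_inv
    have : (τ * σ) v = 0 := by rw [mul_apply_eq_comp, ← hSS, mul_apply_eq_comp, h0]; simp
    rw [hτ] at this
    exact hv this
  rw [← hSS, mul_apply_eq_comp, ← ContinuousLinearMap.adjoint_inner_left,
    (isSelfAdjoint_rpow σ _).adjoint_eq]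
  rw [show (inner ℂ (S v) (S v)).re = ‖S v‖ ^ 2 from inner_self_eq_norm_sq (𝕜 := ℂ) _]
  positivity

variable [FiniteDimensional ℂ H]

theorem eq_zero_of_re_tr_mul_eq_zero (hσ : IsStrictlyPositive σ) (hD : 0 ≤ D)
    (h : (tr (σ * D)).re = 0) : D = 0 := by
  obtain ⟨f, m, hm, hf⟩ := exists_eigenbasis hD
  rw [tr_mul_eq_sum hf, Finset.sum_eq_zero_iff_of_nonneg
    fun k _ => mul_nonneg (hm k) (re_inner_nonneg hσ.nonneg _)] at h
  refine ext_basis f fun k => ?_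
  have := (mul_eq_zero.1 (h k (Finset.mem_univ k))).resolve_right
    (re_inner_pos_of_isStrictlyPositive hσ (f.toBasis.ne_zero k)).ne'
  rw [hf, this]
  simp

end Operators

/-! ### Completely positive maps -/

section CompletelyPositive

variable {H : Type*} [NormedAddCommGroup H] [InnerProductSpace ℂ H] [CompleteSpace H]
  {Φ : (H →L[ℂ] H) →ₗ[ℂ] (H →L[ℂ] H)}

/-- The quadratic form description of complete positivity: `∑ ⟨x c, Φ(A c^* A d) x d⟩ ≥ 0`. -/
theorem IsCompletelyPositive.sum_inner_nonneg {Φ : (H →L[ℂ] H) →ₗ[ℂ] (H →L[ℂ] H)}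
    (hΦ : IsCompletelyPositive Φ) {κ : Type*} [Fintype κ] (A : κ → H →L[ℂ] H) (x : κ → H) :
    0 ≤ (∑ c, ∑ d, inner ℂ (x c) (Φ (star (A c) * A d) (x d))).re := by
  classical
  obtain ⟨Ψ, rfl⟩ := hΦ
  rcases isEmpty_or_nonempty κ with hκ | ⟨⟨o⟩⟩
  · simp
  -- the matrix with the row `A` in position `o` and zeros elsewhere
  set m : CStarMatrix κ κ (H →L[ℂ] H) :=
    CStarMatrix.ofMatrix fun i j => if i = o then A j else 0
  have hmo : ∀ i j, m i j = if i = o then A j else 0 := fun _ _ => rfl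
  have hm0 : 0 ≤ star m * m := star_mul_self_nonneg m
  have hquad : ∀ N : CStarMatrix κ κ (H →L[ℂ] H), 0 ≤ N →
      0 ≤ (∑ c, ∑ d, inner ℂ (x c) (N c d (x d))).re := by
    intro N hN
    rw [StarOrderedRing.nonneg_iff] at hN
    induction hN using AddSubmonoid.closure_induction with
    | mem N hN =>
      obtain ⟨n, rfl⟩ := hN
      have : ∑ c, ∑ d, inner ℂ (x c) ((star n * n) c d (x d))
          = ∑ i, inner ℂ (∑ c, n i c (x c)) (∑ d, n i d (x d)) := by
        simp only [CStarMatrix.mul_apply, CStarMatrix.star_apply, sum_apply, inner_sum, sum_inner,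
          mul_apply_eq_comp, ContinuousLinearMap.star_eq_adjoint,
          ContinuousLinearMap.adjoint_inner_right]
        rw [Finset.sum_comm]
        simp_rw [Finset.sum_comm (s := (Finset.univ : Finset κ)) (t := Finset.univ)
          (f := fun c i => inner ℂ (n i c (x c)) (n i _ (x _)))]
        exact Finset.sum_comm
      rw [this, Complex.re_sum]
      exact Finset.sum_nonneg fun i _ => inner_self_nonneg (𝕜 := ℂ)
    | zero => simp
    | add N M _ _ hN hM =>
      simp only [CStarMatrix.add_apply, add_apply, inner_add_right,
        Finset.sum_add_distrib, Complex.add_re]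
      exact add_nonneg hN hM
  convert hquad _ (CompletelyPositiveMap.map_cstarMatrix_nonneg Ψ _ hm0) using 7 with c _ d
  rw [CStarMatrix.map_apply, CStarMatrix.mul_apply]
  change _ = Ψ.toLinearMap _
  congr 1
  rw [Finset.sum_eq_single o]
  · rw [CStarMatrix.star_apply, hmo, hmo, if_pos rfl, if_pos rfl]
  · intro i _ hi
    rw [hmo, if_neg hi, mul_zero]
  · simp

theorem IsCompletelyPositive.map_star (hΦ : IsCompletelyPositive Φ) (X : H →L[ℂ] H) :
    Φ (star X) = star (Φ X) := by
  obtain ⟨Ψ, rfl⟩ := hΦ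
  have hsa : ∀ Y : H →L[ℂ] H, IsSelfAdjoint Y → star (Ψ.toLinearMap Y) = Ψ.toLinearMap Y :=
    fun Y hY => hY.map' Ψ
  rw [← realPart_add_I_smul_imaginaryPart X]
  simp only [star_add, star_smul, map_add, map_smul, hsa _ (realPart X).2,
    hsa _ (imaginaryPart X).2, (realPart X).2.star_eq, (imaginaryPart X).2.star_eq]

theorem IsCompletelyPositive.map_nonneg (hΦ : IsCompletelyPositive Φ) {X : H →L[ℂ] H}
    (hX : 0 ≤ X) : 0 ≤ Φ X := by
  obtain ⟨Ψ, rfl⟩ := hΦ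
  have := OrderHomClass.mono Ψ hX
  rwa [map_zero] at this

/-- The Schwarz inequality `Φ(X)^* Φ(X) ≤ Φ(X^* X)` for a unital completely positive map. -/
theorem IsCompletelyPositive.schwarz (hΦ : IsCompletelyPositive Φ) (h1 : Φ 1 = 1)
    (X : H →L[ℂ] H) : 0 ≤ Φ (star X * X) - star (Φ X) * Φ X := by
  rw [ContinuousLinearMap.nonneg_iff_isPositive, ContinuousLinearMap.isPositive_def']
  refine ⟨?_, fun v => ?_⟩
  · rw [IsSelfAdjoint, star_sub, ← hΦ.map_star]
    simp
  · have := hΦ.sum_inner_nonneg ![X, 1] ![v, -Φ X v]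
    simp only [Fin.sum_univ_two, Matrix.cons_val_zero, Matrix.cons_val_one, star_one, one_mul,
      mul_one, h1, hΦ.map_star, map_neg, inner_neg_left, inner_neg_right, neg_neg,
      one_apply_eq_self] at this
    rw [ContinuousLinearMap.reApplyInnerSelf_apply, ← inner_conj_symm, RCLike.conj_re, sub_apply,
      mul_apply_eq_comp, inner_sub_right]
    simp only [ContinuousLinearMap.star_eq_adjoint, ContinuousLinearMap.adjoint_inner_right,
      Complex.add_re, Complex.neg_re] at this ⊢
    simp only [RCLike.re_to_complex, Complex.sub_re]
    linarith

theorem IsCompletelyPositive.norm_apply_le (hΦ : IsCompletelyPositive Φ) (h1 : Φ 1 = 1)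
    (X : H →L[ℂ] H) : ‖Φ X‖ ≤ ‖X‖ := by
  have h2 : star (Φ X) * Φ X ≤ Φ (star X * X) := sub_nonneg.1 (hΦ.schwarz h1 X)
  have h3 : Φ (star X * X) ≤ algebraMap ℝ _ (‖X‖ ^ 2) := by
    have := hΦ.map_nonneg (sub_nonneg.2 (CStarAlgebra.star_mul_le_algebraMap_norm_sq (a := X)))
    rw [map_sub, sub_nonneg] at this
    refine this.trans (le_of_eq ?_)
    rw [Algebra.algebraMap_eq_smul_one, ← Complex.coe_smul, map_smul, h1]
  have h4 := CStarAlgebra.norm_le_norm_of_nonneg_of_le (star_mul_self_nonneg _) (h2.trans h3)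
  rw [CStarRing.norm_star_mul_self, ← sq] at h4
  rcases subsingleton_or_nontrivial H with hH | hH
  · rw [Subsingleton.elim (Φ X) 0, norm_zero]; positivity
  rw [norm_algebraMap', Real.norm_of_nonneg (by positivity)] at h4
  exact (sq_le_sq₀ (norm_nonneg _) (norm_nonneg _)).1 h4

/-- Equality in the Schwarz inequality puts `X` into the multiplicative domain. -/
theorem IsCompletelyPositive.map_star_mul (hΦ : IsCompletelyPositive Φ) (h1 : Φ 1 = 1)
    {X : H →L[ℂ] H} (hX : Φ (star X * X) = star (Φ X) * Φ X) (Y : H →L[ℂ] H) :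
    Φ (star X * Y) = star (Φ X) * Φ Y := by
  set D := Φ (star X * Y) - star (Φ X) * Φ Y with hD
  have hstar : Φ (star Y * X) - star (Φ Y) * Φ X = star D := by
    have : Φ (star Y * X) = star (Φ (star X * Y)) := by rw [← hΦ.map_star, star_mul, star_star]
    rw [this, hD, star_sub, star_mul, star_star]
  -- The Schwarz inequality for `Y - n (conj δ) X` is affine in the real number `n`, and its
  -- slope is a negative multiple of `|δ|²`.
  have hδ : ∀ v, inner ℂ (D v) v = 0 := by
    intro v
    set δ := inner ℂ (D v) v with hδ
    set y := (inner ℂ v ((Φ (star Y * Y) - star (Φ Y) * Φ Y) v)).re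
    have hc : ∀ n : ℝ, 0 ≤ y - 2 * n * ‖δ‖ ^ 2 := by
      intro n
      have hs := hΦ.schwarz h1 (Y + (-(n : ℂ) * starRingEnd ℂ δ) • X)
      have hexp : ∀ W, W = Y + (-(n : ℂ) * starRingEnd ℂ δ) • X → Φ (star W * W) - star (Φ W) * Φ W
          = (Φ (star Y * Y) - star (Φ Y) * Φ Y) + (-(n : ℂ) * starRingEnd ℂ δ) • star D
            + (-(n : ℂ) * δ) • D := by
        rintro W rfl
        rw [← hstar, hD]
        simp only [star_add, star_smul, add_mul, mul_add, map_add, map_smul, smul_mul_assoc,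
          mul_smul_comm, hX, smul_sub, smul_add]
        simp only [star_mul', star_neg, RCLike.star_def, Complex.conj_ofReal, Complex.conj_conj]
        abel
      rw [hexp _ rfl] at hs
      have h2 := (ContinuousLinearMap.nonneg_iff_isPositive _).1 hs |>.re_inner_nonneg_right v
      have h3 : inner ℂ v (D v) = starRingEnd ℂ δ := (inner_conj_symm _ _).symm
      have h3' : inner ℂ v (star D v) = δ := by
        rw [ContinuousLinearMap.star_eq_adjoint, ContinuousLinearMap.adjoint_inner_right]
      simp only [add_apply, smul_apply, inner_add_right, inner_smul_right,
        h3, h3'] at h2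
      have h4 : starRingEnd ℂ δ * δ = ((‖δ‖ ^ 2 : ℝ) : ℂ) := by
        rw [mul_comm, Complex.mul_conj, Complex.normSq_eq_norm_sq]
      rw [mul_assoc, mul_assoc, h4, mul_comm δ, h4] at h2
      simp only [map_add, RCLike.re_to_complex, ← Complex.ofReal_neg, ← Complex.ofReal_mul,
        Complex.ofReal_re] at h2
      linarith
    by_contra hne
    have hpos : 0 < ‖δ‖ ^ 2 := by positivity
    have := hc ((y + 1) / (2 * ‖δ‖ ^ 2))
    have h5 : 2 * ((y + 1) / (2 * ‖δ‖ ^ 2)) * ‖δ‖ ^ 2 = y + 1 := by field_simp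
    linarith
  have h0 : (D : H →ₗ[ℂ] H) = 0 := (inner_map_self_eq_zero _).1 hδ
  exact sub_eq_zero.1 (ContinuousLinearMap.coe_injective h0)

/-- Complete positivity is a closed condition, as positivity of matrices over `B(H)` is. -/
theorem isClosed_completelyPositive :
    IsClosed {Φ : (H →L[ℂ] H) →L[ℂ] (H →L[ℂ] H) | IsCompletelyPositive Φ.toLinearMap} := by
  have : {Φ : (H →L[ℂ] H) →L[ℂ] (H →L[ℂ] H) | IsCompletelyPositive Φ.toLinearMap}
      = ⋂ (k : ℕ) (M : CStarMatrix (Fin k) (Fin k) (H →L[ℂ] H)) (_ : 0 ≤ M),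
        (fun Φ : (H →L[ℂ] H) →L[ℂ] (H →L[ℂ] H) => M.map Φ) ⁻¹' {N | 0 ≤ N} := by
    ext Φ
    simp only [Set.mem_ofPred_eq, Set.mem_iInter, Set.mem_preimage]
    constructor
    · rintro ⟨Ψ, hΨ⟩ k M hM
      have := Ψ.map_cstarMatrix_nonneg' k M hM
      rwa [hΨ] at this
    · intro h
      exact ⟨⟨Φ.toLinearMap, h⟩, rfl⟩
  rw [this]
  refine isClosed_iInter fun k => isClosed_iInter fun M => isClosed_iInter fun _ =>
    CStarAlgebra.isClosed_nonneg.preimage ?_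
  refine continuous_pi fun i => continuous_pi fun j => ?_
  exact (ContinuousLinearMap.apply ℂ (H →L[ℂ] H) (M i j)).continuous

end CompletelyPositive

/-! ### Jump rates of a map on `B(H)` -/

section Sums

theorem sum_comm_four {κ ι M : Type*} [Fintype κ] [Fintype ι] [AddCommMonoid M]
    (F : κ → ι → ι → ι → ι → M) :
    ∑ k, ∑ a, ∑ b, ∑ c, ∑ d, F k a b c d = ∑ a, ∑ b, ∑ c, ∑ d, ∑ k, F k a b c d := by
  rw [Finset.sum_comm]
  refine Finset.sum_congr rfl fun a _ => ?_
  rw [Finset.sum_comm]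
  refine Finset.sum_congr rfl fun b _ => ?_
  rw [Finset.sum_comm]
  exact Finset.sum_congr rfl fun c _ => Finset.sum_comm

theorem sum_comm_pairs {ι M : Type*} [Fintype ι] [AddCommMonoid M] (F : ι → ι → ι → ι → M) :
    ∑ a, ∑ b, ∑ c, ∑ d, F a b c d = ∑ c, ∑ d, ∑ b, ∑ a, F a b c d := by
  calc _ = ∑ b, ∑ c, ∑ d, ∑ a, F a b c d := by
        rw [Finset.sum_comm]
        refine Finset.sum_congr rfl fun b _ => ?_
        rw [Finset.sum_comm]
        exact Finset.sum_congr rfl fun c _ => Finset.sum_comm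
    _ = _ := by
        rw [Finset.sum_comm]
        exact Finset.sum_congr rfl fun c _ => Finset.sum_comm

theorem sum_reverse_four {ι M : Type*} [Fintype ι] [AddCommMonoid M] (F : ι → ι → ι → ι → M) :
    ∑ a, ∑ b, ∑ c, ∑ d, F d c b a = ∑ a, ∑ b, ∑ c, ∑ d, F a b c d := by
  rw [sum_comm_pairs]
  exact Finset.sum_comm

end Sums

section Rates

open InnerProductSpace

variable {H : Type*} [NormedAddCommGroup H] [InnerProductSpace ℂ H]
  {ι : Type*} [Fintype ι] {Φ : (H →L[ℂ] H) →ₗ[ℂ] (H →L[ℂ] H)}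
  {e f : OrthonormalBasis ι ℂ H} {s : ι → ℝ}

/-- The jump rates of a linear map `Φ` on `B(H)`, where `e` diagonalizes the reference state with
eigenvalues `s`, and `f` diagonalizes the observable. For `g = 1` this is the matrix element
`⟨f k, Φ(|f l⟩⟨f l|) f k⟩`; a function `g` of the modular ratio `s a / s c` is inserted into its
expansion in the basis `e`. The real part makes it a real functional for every `Φ`. -/
def rate (e f : OrthonormalBasis ι ℂ H) (s : ι → ℝ) (Φ : (H →L[ℂ] H) →ₗ[ℂ] (H →L[ℂ] H))
    (k l : ι) : (ℝ → ℝ) →ₗ[ℝ] ℝ where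
  toFun g := (∑ a, ∑ b, ∑ c, ∑ d, (g (s a / s c) : ℂ)
    * (inner ℂ (e b) (f k) * inner ℂ (f k) (e a) * (inner ℂ (e c) (f l) * inner ℂ (f l) (e d)))
    * coef e Φ a b c d).re
  map_add' g g' := by
    simp only [Pi.add_apply, Complex.ofReal_add, add_mul, Finset.sum_add_distrib, Complex.add_re]
  map_smul' r g := by
    simp only [Pi.smul_apply, smul_eq_mul, Complex.ofReal_mul, mul_assoc, ← Finset.mul_sum,
      Complex.re_ofReal_mul, RingHom.id_apply]

theorem rate_apply (k l : ι) (g : ℝ → ℝ) :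
    rate e f s Φ k l g = (∑ a, ∑ b, ∑ c, ∑ d, (g (s a / s c) : ℂ)
    * (inner ℂ (e b) (f k) * inner ℂ (f k) (e a) * (inner ℂ (e c) (f l) * inner ℂ (f l) (e d)))
    * coef e Φ a b c d).re := rfl

theorem rate_smul_sub {ι : Type*} [Fintype ι] {e f : OrthonormalBasis ι ℂ H} {s : ι → ℝ} (r : ℝ)
    (Φ Ψ : (H →L[ℂ] H) →ₗ[ℂ] (H →L[ℂ] H)) (k l : ι) (g : ℝ → ℝ) :
    rate e f s ((r : ℂ) • (Φ - Ψ)) k l g = r * (rate e f s Φ k l g - rate e f s Ψ k l g) := by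
  simp only [rate_apply]
  rw [← Complex.sub_re, ← Complex.re_ofReal_mul, ← Finset.sum_sub_distrib, Finset.mul_sum]
  congr 1
  refine Finset.sum_congr rfl fun a _ => ?_
  rw [← Finset.sum_sub_distrib, Finset.mul_sum]
  refine Finset.sum_congr rfl fun b _ => ?_
  rw [← Finset.sum_sub_distrib, Finset.mul_sum]
  refine Finset.sum_congr rfl fun c _ => ?_
  rw [← Finset.sum_sub_distrib, Finset.mul_sum]
  refine Finset.sum_congr rfl fun d _ => ?_
  simp only [coef, LinearMap.smul_apply, LinearMap.sub_apply, smul_apply, sub_apply,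
    inner_smul_right, inner_sub_right]
  ring

/-- The identity map has holding rates only. -/
theorem rate_id (k l : ι) (g : ℝ → ℝ) (hs : ∀ i, 0 < s i) (h : k = l → g 1 = 0) :
    rate e f s LinearMap.id k l g = 0 := by
  classical
  have h1 : ∀ a b c d, coef e (LinearMap.id : (H →L[ℂ] H) →ₗ[ℂ] (H →L[ℂ] H)) a b c d
      = (if a = c then 1 else 0) * (if d = b then 1 else 0) := by
    intro a b c d
    rw [coef, LinearMap.id_apply, rankOne_apply, inner_smul_right,
      orthonormal_iff_ite.mp e.orthonormal, orthonormal_iff_ite.mp e.orthonormal, mul_comm]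
  rw [rate_apply]
  simp only [h1, ← mul_assoc, mul_ite, mul_one, mul_zero, Finset.sum_ite_eq, Finset.sum_ite_eq',
    Finset.mem_univ, if_true, div_self (hs _).ne']
  by_cases hkl : k = l
  · simp [h hkl]
  · have h2 : ∑ a, inner ℂ (f k) (e a) * inner ℂ (e a) (f l) = (0 : ℂ) := by
      rw [e.sum_inner_mul_inner, orthonormal_iff_ite.mp f.orthonormal, if_neg hkl]
    rw [Finset.sum_comm, Finset.sum_eq_zero, Complex.zero_re]
    intro b _
    have : ∀ a, (g 1 : ℂ) * inner ℂ (e b) (f k) * inner ℂ (f k) (e a) * inner ℂ (e a) (f l)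
        * inner ℂ (f l) (e b) = ((g 1 : ℂ) * inner ℂ (e b) (f k) * inner ℂ (f l) (e b))
          * (inner ℂ (f k) (e a) * inner ℂ (e a) (f l)) := fun a => by ring
    simp only [this, ← Finset.mul_sum, h2, mul_zero]

/-- A map with `Φ(1) = 0` conserves mass, as `∑ l, |f l⟩⟨f l| = 1`. -/
theorem sum_rate_one (hΦ1 : Φ 1 = 0) (k : ι) : ∑ l, rate e f s Φ k l (fun _ => 1) = 0 := by
  classical
  simp only [rate_apply, ← Complex.re_sum]
  rw [sum_comm_four]
  have h1 : ∀ a b, ∑ c, coef e Φ a b c c = 0 := by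
    intro a b
    simp only [coef, ← inner_sum, ← sum_apply, ← map_sum]
    rw [e.sum_rankOne_eq_id]
    have : Φ (ContinuousLinearMap.id ℂ H) = 0 := hΦ1
    simp [this]
  have h2 : ∀ c d, ∑ l, inner ℂ (e c) (f l) * inner ℂ (f l) (e d)
      = if c = d then (1 : ℂ) else 0 := by
    intro c d
    rw [f.sum_inner_mul_inner, orthonormal_iff_ite.mp e.orthonormal]
  simp only [← Finset.sum_mul, ← Finset.mul_sum, h2]
  simp [mul_assoc, ← Finset.mul_sum, h1]

theorem inner_apply_eq_sum {K : H →L[ℂ] H} {α : ι → ℝ} (hK : ∀ k, K (f k) = (α k : ℂ) • f k)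
    (x y : H) : inner ℂ x (K y) = ∑ k, (α k : ℂ) * (inner ℂ x (f k) * inner ℂ (f k) y) := by
  conv_lhs => rw [← f.sum_repr' y]
  simp only [map_sum, map_smul, hK, inner_sum, inner_smul_right]
  exact Finset.sum_congr rfl fun k _ => by ring

/-- Summation of the rates against eigenvalues reassembles the operators `K` and `N`. -/
theorem sum_mul_rate {K N : H →L[ℂ] H} {α β : ι → ℝ} (hK : ∀ k, K (f k) = (α k : ℂ) • f k)
    (hN : ∀ k, N (f k) = (β k : ℂ) • f k) (g : ℝ → ℝ) :
    ∑ k, ∑ l, α k * β l * rate e f s Φ k l g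
      = (∑ a, ∑ b, ∑ c, ∑ d, (g (s a / s c) : ℂ)
          * (inner ℂ (e b) (K (e a)) * inner ℂ (e c) (N (e d))) * coef e Φ a b c d).re := by
  simp only [rate_apply, ← Complex.re_ofReal_mul, ← Complex.re_sum]
  congr 1
  simp only [inner_apply_eq_sum hK, inner_apply_eq_sum hN, Finset.mul_sum,
    Finset.sum_mul]
  calc _ = ∑ k, ∑ a, ∑ b, ∑ c, ∑ d, ∑ l, _ :=
        Finset.sum_congr rfl fun k _ => sum_comm_four _
    _ = ∑ a, ∑ b, ∑ c, ∑ d, ∑ k, ∑ l, _ := sum_comm_four _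
    _ = _ := by
      refine Finset.sum_congr rfl fun a _ => Finset.sum_congr rfl fun b _ =>
        Finset.sum_congr rfl fun c _ => Finset.sum_congr rfl fun d _ => ?_
      rw [Finset.sum_comm]
      refine Finset.sum_congr rfl fun k _ => Finset.sum_congr rfl fun l _ => ?_
      push_cast
      ring

variable [CompleteSpace H] {σ : H →L[ℂ] H}

/-- The correlation `Tr[S K S Φ(T N T)]` as an integral against the rates. -/
theorem re_tr_sandwich {S T : H →L[ℂ] H} (hS : IsSelfAdjoint S) (hT : IsSelfAdjoint T) {u v : ι → ℝ}
    (hu : ∀ i, S (e i) = (u i : ℂ) • e i) (hv : ∀ i, T (e i) = (v i : ℂ) • e i)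
    {K N : H →L[ℂ] H} {α β : ι → ℝ} (hK : ∀ k, K (f k) = (α k : ℂ) • f k)
    (hN : ∀ k, N (f k) = (β k : ℂ) • f k) {g : ℝ → ℝ}
    (hg : ∀ a b c d, coef e Φ a b c d ≠ 0 → u a * u b * (v c * v d) = g (s a / s c)) :
    (tr (S * K * S * Φ (T * N * T))).re = ∑ k, ∑ l, α k * β l * rate e f s Φ k l g := by
  rw [tr_sandwich e Φ hS hT hu hv, sum_mul_rate hK hN]
  congr 1
  refine Finset.sum_congr rfl fun a _ => Finset.sum_congr rfl fun b _ =>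
    Finset.sum_congr rfl fun c _ => Finset.sum_congr rfl fun d _ => ?_
  by_cases h : coef e Φ a b c d = 0
  · rw [h, mul_zero, mul_zero]
  · rw [hg a b c d h]

/-- `Φ` is selfadjoint for the scalar product `(X, Y) ↦ Tr[σ X^* Y]` and preserves
selfadjointness. -/
structure IsGNSSymmetric (σ : H →L[ℂ] H) (Φ : (H →L[ℂ] H) →ₗ[ℂ] (H →L[ℂ] H)) : Prop where
  tr_eq : ∀ X Y, tr (σ * (X * Φ Y)) = tr (σ * (Φ X * Y))
  map_star : ∀ X, Φ (star X) = star (Φ X)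

/-- `Φ` preserves adjoints, in coordinates. -/
theorem star_coef (hΦ : IsGNSSymmetric σ Φ) (a b c d : ι) :
    starRingEnd ℂ (coef e Φ a b c d) = coef e Φ b a d c := by
  have : rankOne ℂ (e d) (e c) = star (rankOne ℂ (e c) (e d)) := by
    rw [ContinuousLinearMap.star_eq_adjoint, adjoint_rankOne]
  rw [coef, coef, inner_conj_symm, this, hΦ.map_star, ContinuousLinearMap.star_eq_adjoint,
    ContinuousLinearMap.adjoint_inner_right]

variable [FiniteDimensional ℂ H]

/-- GNS symmetry, in coordinates. -/
theorem coef_gns (hΦ : IsGNSSymmetric σ Φ) (hσ : IsSelfAdjoint σ)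
    (he : ∀ i, σ (e i) = (s i : ℂ) • e i) (a b c d : ι) :
    s b * coef e Φ a b c d = s d * coef e Φ d c b a := by
  have := hΦ.tr_eq (rankOne ℂ (e b) (e a)) (rankOne ℂ (e c) (e d))
  rw [← mul_assoc σ (Φ _), tr_mul_rankOne, tr_mul_comm, mul_assoc, tr_mul_comm, tr_mul_rankOne,
    mul_apply_eq_comp, mul_apply_eq_comp, inner_apply_basis hσ he, he, map_smul,
    inner_smul_right] at this
  exact this

/-- The complex conjugate of `coef_gns`. It has the other eigenvalue of `σ`, and the comparison of
the two gives the modular covariance `ratio_eq_of_coef_ne_zero`. -/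
theorem coef_gns' (hΦ : IsGNSSymmetric σ Φ) (hσ : IsSelfAdjoint σ)
    (he : ∀ i, σ (e i) = (s i : ℂ) • e i) (a b c d : ι) :
    s a * coef e Φ a b c d = s c * coef e Φ d c b a := by
  have := congrArg (starRingEnd ℂ) (coef_gns hΦ hσ he b a d c)
  simpa [star_coef hΦ] using this

/-- A GNS-symmetric map commutes with the modular group of `σ`, which acts on `|e a⟩⟨e c|` through
the ratio `s a / s c` of eigenvalues. -/
theorem ratio_eq_of_coef_ne_zero (hΦ : IsGNSSymmetric σ Φ) (hσ : IsSelfAdjoint σ)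
    (he : ∀ i, σ (e i) = (s i : ℂ) • e i) (hs : ∀ i, 0 < s i) {a b c d : ι}
    (h : coef e Φ a b c d ≠ 0) : s a / s c = s b / s d := by
  have h1 := coef_gns hΦ hσ he a b c d
  have h2 := coef_gns' hΦ hσ he a b c d
  have : ((s a * s d : ℝ) : ℂ) * coef e Φ a b c d = ((s b * s c : ℝ) : ℂ) * coef e Φ a b c d := by
    push_cast
    linear_combination (s d : ℂ) * h2 - (s c : ℂ) * h1
  have := mul_right_cancel₀ h this
  rw [div_eq_div_iff (hs c).ne' (hs d).ne']
  exact_mod_cast this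

/-- Detailed balance for the rates of a GNS-symmetric map. -/
theorem rate_symm (hΦ : IsGNSSymmetric σ Φ) (hσ : IsSelfAdjoint σ)
    (he : ∀ i, σ (e i) = (s i : ℂ) • e i) (hs : ∀ i, 0 < s i) (k l : ι) (g : ℝ → ℝ) :
    rate e f s Φ k l g = rate e f s Φ l k fun ω => ω * g ω⁻¹ := by
  rw [rate_apply, rate_apply]
  rw [← sum_reverse_four fun a b c d => ((s a / s c * g (s a / s c)⁻¹ : ℝ) : ℂ)
    * (inner ℂ (e b) (f l) * inner ℂ (f l) (e a) * (inner ℂ (e c) (f k) * inner ℂ (f k) (e d)))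
    * coef e Φ a b c d]
  congr 1
  refine Finset.sum_congr rfl fun a _ => Finset.sum_congr rfl fun b _ =>
    Finset.sum_congr rfl fun c _ => Finset.sum_congr rfl fun d _ => ?_
  have hφ : coef e Φ a b c d = ((s d / s b : ℝ) : ℂ) * coef e Φ d c b a := by
    have hb : (s b : ℂ) ≠ 0 := by exact_mod_cast (hs b).ne'
    push_cast
    rw [div_mul_eq_mul_div, eq_div_iff hb, ← coef_gns hΦ hσ he, mul_comm]
  by_cases h : coef e Φ a b c d = 0
  · have h' : coef e Φ d c b a = 0 := by
      have : ((s d / s b : ℝ) : ℂ) ≠ 0 := by exact_mod_cast (div_pos (hs d) (hs b)).ne'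
      exact (mul_eq_zero.1 (hφ ▸ h)).resolve_left this
    rw [h, h', mul_zero, mul_zero]
  · rw [ratio_eq_of_coef_ne_zero hΦ hσ he hs h, hφ, inv_div]
    push_cast
    ring

/-- The rates of a completely positive map are positive measures. By modular covariance
`g (s a / s c)` may be replaced by `√g (s a / s c) * √g (s b / s d)`, which turns the rate into a
value of the quadratic form of complete positivity. -/
theorem rate_nonneg_of_completelyPositive (hΦ : IsGNSSymmetric σ Φ) (hσ : IsSelfAdjoint σ)
    (he : ∀ i, σ (e i) = (s i : ℂ) • e i) (hs : ∀ i, 0 < s i) (hcp : IsCompletelyPositive Φ)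
    (k l : ι) (g : ℝ → ℝ) (hg : ∀ a c, 0 ≤ g (s a / s c)) : 0 ≤ rate e f s Φ k l g := by
  rcases isEmpty_or_nonempty ι with hι | ⟨⟨o⟩⟩
  · simp [rate_apply]
  -- The fixed vector `e o` makes the products `A c^* A d` into the matrix units `|e c⟩⟨e d|`.
  have hpos := hcp.sum_inner_nonneg (fun c => rankOne ℂ (e o) (e c)) fun c =>
    ∑ a, (((Real.sqrt (g (s a / s c)) : ℝ) : ℂ) * (inner ℂ (e a) (f k) * inner ℂ (f l) (e c))) • e a
  convert hpos using 2
  have hrank : ∀ c d, star (rankOne ℂ (e o) (e c)) * rankOne ℂ (e o) (e d)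
      = rankOne ℂ (e c) (e d) := by
    intro c d
    rw [ContinuousLinearMap.star_eq_adjoint, adjoint_rankOne]
    ext v
    simp [rankOne_apply]
  simp only [hrank, map_sum, map_smul, inner_sum, sum_inner, inner_smul_left, inner_smul_right,
    map_mul, Complex.conj_ofReal, inner_conj_symm]
  rw [rate_apply]
  congr 1
  rw [sum_comm_pairs]
  simp only [Finset.mul_sum]
  refine Finset.sum_congr rfl fun c _ => Finset.sum_congr rfl fun d _ =>
    Finset.sum_congr rfl fun b _ => Finset.sum_congr rfl fun a _ => ?_
  change _ = _ * (_ * coef e Φ a b _ _)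
  by_cases h : coef e Φ a b c d = 0
  · rw [h]
    ring
  · have h3 : (g (s a / s c) : ℂ)
        = (Real.sqrt (g (s a / s c)) : ℂ) * Real.sqrt (g (s b / s d)) := by
      rw [← ratio_eq_of_coef_ne_zero hΦ hσ he hs h, ← Complex.ofReal_mul,
        Real.mul_self_sqrt (hg a c)]
    rw [h3]
    ring

end Rates

/-! ### Dirichlet forms in terms of jump rates -/

section Inequality

open InnerProductSpace

variable {H : Type*} [NormedAddCommGroup H] [InnerProductSpace ℂ H] [CompleteSpace H]
  [FiniteDimensional ℂ H] {ι : Type*} [Fintype ι] {σ : H →L[ℂ] H}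
  {L : (H →L[ℂ] H) →ₗ[ℂ] (H →L[ℂ] H)} {e f : OrthonormalBasis ι ℂ H} {s : ι → ℝ}

/-- The properties of the generator of a semigroup that is selfadjoint for the GNS scalar product
of `σ`, as far as they are seen by the jump rates. -/
structure IsGNSGenerator (σ : H →L[ℂ] H) (L : (H →L[ℂ] H) →ₗ[ℂ] (H →L[ℂ] H)) : Prop where
  gns : IsGNSSymmetric σ L
  map_one : L 1 = 0
  /-- Conditional positivity. -/
  rate_nonneg : ∀ {e f : OrthonormalBasis (Fin (Module.finrank ℂ H)) ℂ H}
    {s : Fin (Module.finrank ℂ H) → ℝ}, (∀ i, 0 < s i) → (∀ i, σ (e i) = (s i : ℂ) • e i) →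
    ∀ k l g, (∀ a c, 0 ≤ g (s a / s c)) → (k = l → g 1 = 0) → 0 ≤ rate e f s L k l g

theorem IsGNSGenerator.isRateFamily (hL : IsGNSGenerator σ L) (hσ : IsSelfAdjoint σ)
    {e f : OrthonormalBasis (Fin (Module.finrank ℂ H)) ℂ H}
    {s : Fin (Module.finrank ℂ H) → ℝ}
    (hs : ∀ i, 0 < s i) (he : ∀ i, σ (e i) = (s i : ℂ) • e i) :
    IsRateFamily (insert 1 (Set.range fun x : _ × _ => s x.1 / s x.2)) (rate e f s L) where
  finite := (Set.finite_range _).insert _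
  pos := by
    rintro ω (rfl | ⟨x, rfl⟩)
    · exact one_pos
    · exact div_pos (hs _) (hs _)
  one_mem := Set.mem_insert _ _
  nonneg k l g hg h1 := hL.rate_nonneg hs he k l g (fun a c => hg _ (.inr ⟨(a, c), rfl⟩)) h1
  symm k l g := rate_symm hL.gns hσ he hs k l g
  sum_one k := sum_rate_one hL.map_one k

/-- The weights `s ^ u` to the left and `s ^ (-u)` to the right combine, where the coefficient does
not vanish, to a power of the modular ratio. -/
theorem rpow_weights (hL : IsGNSSymmetric σ L) (hσ : IsSelfAdjoint σ) (hs : ∀ i, 0 < s i)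
    (he : ∀ i, σ (e i) = (s i : ℂ) • e i) {u z : ℝ} (hu : u + u = z) {a b c d : ι}
    (h : coef e L a b c d ≠ 0) :
    s a ^ u * s b ^ u * (s c ^ (-u) * s d ^ (-u)) = (s a / s c) ^ z := by
  have h1 := ratio_eq_of_coef_ne_zero hL hσ he hs h
  rw [← hu, Real.rpow_add (div_pos (hs a) (hs c))]
  conv_rhs => rw [h1, ← h1]
  nth_rewrite 2 [h1]
  rw [Real.div_rpow (hs a).le (hs c).le, Real.div_rpow (hs b).le (hs d).le,
    Real.rpow_neg (hs c).le, Real.rpow_neg (hs d).le]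
  have := (Real.rpow_pos_of_pos (hs c) u).ne'
  have := (Real.rpow_pos_of_pos (hs d) u).ne'
  field_simp

/-- The correlation of `K` with `σ ^ u * X * σ ^ u` through `L`, in terms of the rates. -/
theorem re_tr_modular (hL : IsGNSSymmetric σ L) (hσ : IsStrictlyPositive σ) (hs : ∀ i, 0 < s i)
    (he : ∀ i, σ (e i) = (s i : ℂ) • e i) {u z : ℝ} (hu : u + u = z) (X : H →L[ℂ] H)
    {K : H →L[ℂ] H} {α r : ι → ℝ} (hK : ∀ k, K (f k) = (α k : ℂ) • f k)
    (hX : ∀ k, (σ ^ u * X * σ ^ u) (f k) = (r k : ℂ) • f k) :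
    (tr (σ ^ u * K * σ ^ u * L X)).re
      = ∑ k, ∑ l, α k * r l * rate e f s L k l (fun ω => ω ^ z) := by
  conv_lhs => rw [← rpow_sandwich hσ u X]
  exact re_tr_sandwich (isSelfAdjoint_rpow _ _) (isSelfAdjoint_rpow _ _)
    (rpow_apply_basis hσ.nonneg he _) (rpow_apply_basis hσ.nonneg he _) hK hX
    fun a b c d h => rpow_weights hL hσ.isSelfAdjoint hs he hu h

theorem re_kms_powerMap (hL : IsGNSSymmetric σ L) (hσ : IsStrictlyPositive σ)
    (hs : ∀ i, 0 < s i) (he : ∀ i, σ (e i) = (s i : ℂ) • e i) {r p : ℝ} (hrp : r⁻¹ + p⁻¹ = 1)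
    {X : H →L[ℂ] H} (hX : 0 ≤ σ ^ (1 / (2 * p)) * X * σ ^ (1 / (2 * p))) {m : ι → ℝ}
    (hf : ∀ k, (σ ^ (1 / (2 * p)) * X * σ ^ (1 / (2 * p))) (f k) = (m k : ℂ) • f k) :
    (kms σ (powerMap σ r p X) (L X)).re
      = ∑ k, ∑ l, m k ^ (p / r) * m l * rate e f s L k l (fun ω => ω ^ p⁻¹) := by
  have hsum : σ ^ (1 / 2 : ℝ) * σ ^ (-(1 / (2 * r))) = σ ^ (1 / (2 * p)) := by
    rw [← CFC.rpow_add hσ.isUnit]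
    congr 1
    rw [one_div (2 * r), one_div (2 * p), mul_inv, mul_inv]
    linarith
  have hsum' : σ ^ (-(1 / (2 * r))) * σ ^ (1 / 2 : ℝ) = σ ^ (1 / (2 * p)) := by
    rw [← hsum, ← CFC.rpow_add hσ.isUnit, ← CFC.rpow_add hσ.isUnit, add_comm]
  rw [kms, powerMap, CFC.abs_of_nonneg _ hX]
  simp only [star_mul, (isSelfAdjoint_rpow _ _).star_eq]
  rw [show ∀ a b c g : H →L[ℂ] H, a * (b * (c * b)) * a * g = (a * b) * c * (b * a) * g by
    intros; simp only [mul_assoc], hsum, hsum']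
  exact re_tr_modular hL hσ hs he (by rw [one_div, mul_inv]; ring) X (rpow_apply_basis hX hf _) hf

/-- The `2`-Dirichlet form in terms of the rates, where `m ^ p` are the eigenvalues of the `p`-th
power. -/
theorem pDirichletReal_two_powerMap (hL : IsGNSSymmetric σ L) (hσ : IsStrictlyPositive σ)
    (hs : ∀ i, 0 < s i) (he : ∀ i, σ (e i) = (s i : ℂ) • e i) {p : ℝ}
    {X : H →L[ℂ] H} (hX : 0 ≤ σ ^ (1 / (2 * p)) * X * σ ^ (1 / (2 * p))) {R : Set ℝ}
    (hR : IsRateFamily R (rate e f s L)) {m : ι → ℝ} (hm : ∀ k, 0 ≤ m k)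
    (hf : ∀ k, (σ ^ (1 / (2 * p)) * X * σ ^ (1 / (2 * p))) (f k) = (m k : ℂ) • f k) :
    pDirichletReal σ L 2 (powerMap σ 2 p X)
      = -pairSum (rate e f s L) (fun k => m k ^ p)
        (fun x y => x ^ (1 / 2 : ℝ) * y ^ (1 / 2 : ℝ)) := by
  have h1 := sandwich_powerMap (r := 2) hσ hX
  have hc : Real.conjExponent 2 = 2 := by norm_num [Real.conjExponent]
  rw [pDirichletReal, hc, re_kms_powerMap hL hσ hs he (by norm_num)
    (by rw [h1]; exact CFC.rpow_nonneg)
    (fun k => by rw [h1]; exact rpow_apply_basis hX hf _ k), pairSum]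
  rw [show -(2 / (2 * (2 - 1)) : ℝ) = -1 by norm_num, neg_one_mul]
  congr 1
  refine Finset.sum_congr rfl fun k _ => Finset.sum_congr rfl fun l _ => ?_
  rw [← smul_eq_mul (b := rate e f s L k l _), ← map_smul]
  refine hR.congr k l fun ω hω => ?_
  simp only [Pi.smul_apply, smul_eq_mul]
  rw [Real.mul_rpow (hR.pos ω hω).le (Real.rpow_nonneg (hm l) _), ← Real.rpow_mul (hm k),
    ← Real.rpow_mul (hm l), ← Real.rpow_mul (hm k)]
  norm_num
  ring_nf

/-- The `p`-Dirichlet form in terms of the rates. -/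
theorem pDirichletReal_eq (hL : IsGNSSymmetric σ L) (hσ : IsStrictlyPositive σ)
    (hs : ∀ i, 0 < s i) (he : ∀ i, σ (e i) = (s i : ℂ) • e i) {p : ℝ} (hp : 1 < p)
    {X : H →L[ℂ] H} (hX : 0 ≤ σ ^ (1 / (2 * p)) * X * σ ^ (1 / (2 * p))) {R : Set ℝ}
    (hR : IsRateFamily R (rate e f s L)) {m : ι → ℝ} (hm : ∀ k, 0 ≤ m k)
    (hf : ∀ k, (σ ^ (1 / (2 * p)) * X * σ ^ (1 / (2 * p))) (f k) = (m k : ℂ) • f k) :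
    pDirichletReal σ L p X = -(p / (2 * (p - 1))) * pairSum (rate e f s L) (fun k => m k ^ p)
        (fun x y => x ^ (1 - p⁻¹) * y ^ p⁻¹) := by
  have hp0 : p ≠ 0 := by positivity
  have hp1 : p - 1 ≠ 0 := by linarith
  rw [pDirichletReal, re_kms_powerMap hL hσ hs he
    (by rw [Real.conjExponent]; field_simp; ring) hX hf, pairSum]
  congr 1
  refine Finset.sum_congr rfl fun k _ => Finset.sum_congr rfl fun l _ => ?_
  rw [← smul_eq_mul (b := rate e f s L k l _), ← map_smul]
  refine hR.congr k l fun ω hω => ?_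
  simp only [Pi.smul_apply, smul_eq_mul]
  rw [Real.mul_rpow (hR.pos ω hω).le (Real.rpow_nonneg (hm l) _), ← Real.rpow_mul (hm k),
    ← Real.rpow_mul (hm l), mul_inv_cancel₀ hp0, Real.rpow_one,
    show p / p.conjExponent = p * (1 - p⁻¹) by rw [Real.conjExponent]; field_simp]
  ring

/-- The part `Tr[M log σ]` of the `1`-Dirichlet form in terms of the rates. The function of the
modular ratio `s a / s c` is `ω * log ω`, with `log ω = log (s a) - log (s c)`; the term with
`log (s c)` drops out, because `σ` is invariant. -/
theorem re_tr_log (hL : IsGNSSymmetric σ L) (hL1 : L 1 = 0) (hσ : IsStrictlyPositive σ)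
    (hs : ∀ i, 0 < s i) (he : ∀ i, σ (e i) = (s i : ℂ) • e i) (X : H →L[ℂ] H) {m : ι → ℝ}
    (hf : ∀ k, (σ ^ (1 / 2 : ℝ) * X * σ ^ (1 / 2 : ℝ)) (f k) = (m k : ℂ) • f k) :
    (tr (σ ^ (1 / 2 : ℝ) * CFC.log σ * σ ^ (1 / 2 : ℝ) * L X)).re
      = ∑ k, ∑ l, m l * rate e f s L k l (fun ω => ω * Real.log ω) := by
  classical
  set N := σ ^ (1 / 2 : ℝ) * X * σ ^ (1 / 2 : ℝ) with hN
  have hsum := sum_mul_rate (e := e) (s := s) (Φ := L) (K := 1) (α := fun _ => 1) (f := f)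
    (by simp) hf (fun ω => ω * Real.log ω)
  simp only [one_mul] at hsum
  rw [hsum, ← rpow_sandwich hσ (1 / 2) X, ← hN, tr_sandwich e L (isSelfAdjoint_rpow _ _)
    (isSelfAdjoint_rpow _ _) (rpow_apply_basis hσ.nonneg he _) (rpow_apply_basis hσ.nonneg he _)]
  congr 1
  have hlog : ∀ a b, inner ℂ (e b) (CFC.log σ (e a))
      = if b = a then ((Real.log (s a) : ℝ) : ℂ) else 0 := by
    intro a b
    rw [CFC.log, cfc_apply_basis hσ.isSelfAdjoint he, inner_smul_right,
      orthonormal_iff_ite.mp e.orthonormal]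
    simp
  have hone : ∀ a b, inner ℂ (e b) ((1 : H →L[ℂ] H) (e a)) = if b = a then (1 : ℂ) else 0 :=
    fun a b => orthonormal_iff_ite.mp e.orthonormal b a
  simp only [hlog, hone, ite_mul, mul_ite, zero_mul, mul_zero, one_mul]
  -- invariance of `σ`, in coordinates
  have hinv : ∀ c d, ∑ a, (s a : ℂ) * coef e L a a c d = 0 := by
    intro c d
    have h1 : ∀ b, ∑ a, coef e L b c a a = 0 := by
      intro b
      simp only [coef, ← inner_sum, ← sum_apply, ← map_sum]
      rw [e.sum_rankOne_eq_id]
      have : L (ContinuousLinearMap.id ℂ H) = 0 := hL1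
      simp [this]
    simp only [coef_gns hL hσ.isSelfAdjoint he, ← Finset.mul_sum, h1, mul_zero]
  have hcorr : ∑ a, ∑ c, ∑ d, ((Real.log (s c) / s c : ℝ) : ℂ) * inner ℂ (e c) (N (e d))
      * (s a * coef e L a a c d) = 0 := by
    rw [Finset.sum_comm]
    refine Finset.sum_eq_zero fun c _ => ?_
    rw [Finset.sum_comm]
    refine Finset.sum_eq_zero fun d _ => ?_
    rw [← Finset.mul_sum, hinv, mul_zero]
  refine sub_eq_zero.1 (Eq.trans ?_ hcorr)
  rw [← Finset.sum_sub_distrib]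
  refine Finset.sum_congr rfl fun a _ => ?_
  have hpick : ∀ F : ι → ι → ι → ℂ,
      ∑ b, ∑ c, ∑ d, (if b = a then F b c d else 0) = ∑ c, ∑ d, F a c d := by
    intro F
    rw [Finset.sum_eq_single a]
    · simp
    · intro b _ hb
      simp [hb]
    · simp
  rw [hpick, hpick, ← Finset.sum_sub_distrib]
  refine Finset.sum_congr rfl fun c _ => ?_
  rw [← Finset.sum_sub_distrib]
  refine Finset.sum_congr rfl fun d _ => ?_
  by_cases h : coef e L a a c d = 0
  · simp [h]
  rw [rpow_weights hL hσ.isSelfAdjoint hs he (z := 1) (by norm_num) h, Real.rpow_one,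
    Real.log_div (hs a).ne' (hs c).ne']
  push_cast
  ring

/-- Regularity for the generator of a semigroup that is symmetric for the GNS scalar product of a
faithful state. -/
theorem IsGNSGenerator.regular (hL : IsGNSGenerator σ L) (hσ : IsStrictlyPositive σ) {p : ℝ}
    (hp : 1 ≤ p) {X : H →L[ℂ] H} (hX : 0 ≤ X) :
    ((2 / p : ℝ) : EReal) * pDirichlet σ L 2 (powerMap σ 2 p X) ≤ pDirichlet σ L p X := by
  obtain ⟨e, s, hs0, he⟩ := exists_eigenbasis hσ.nonneg
  have hs : ∀ i, 0 < s i := fun i => by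
    refine lt_of_le_of_ne (hs0 i) fun h0 => e.toBasis.ne_zero i ?_
    obtain ⟨τ, hτ⟩ := hσ.isUnit.exists_left_inv
    have : (τ * σ) (e i) = 0 := by rw [mul_apply_eq_comp, he, ← h0]; simp
    rwa [hτ] at this
  set Y := σ ^ (1 / (2 * p)) * X * σ ^ (1 / (2 * p)) with hYdef
  have hY : 0 ≤ Y := (isSelfAdjoint_rpow σ _).conjugate_nonneg hX
  obtain ⟨f, m, hm, hf⟩ := exists_eigenbasis hY
  have hR := hL.isRateFamily (f := f) hσ.isSelfAdjoint hs he
  have h2 : pDirichlet σ L 2 (powerMap σ 2 p X) = ((-pairSum (rate e f s L) (fun k => m k ^ p)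
        (fun x y => x ^ (1 / 2 : ℝ) * y ^ (1 / 2 : ℝ)) : ℝ) : EReal) := by
    rw [pDirichlet, if_neg (by norm_num), pDirichletReal_two_powerMap hL.gns hσ hs he hY hR hm hf]
  rw [h2, ← EReal.coe_mul]
  have hμ : ∀ k, 0 ≤ m k ^ p := fun k => Real.rpow_nonneg (hm k) p
  rcases hp.eq_or_lt with rfl | hp
  · have hu : (1 / (2 * 1) : ℝ) = 1 / 2 := by norm_num
    rw [hu] at hYdef
    simp only [Real.rpow_one, div_one]
    have hf' := hf
    simp only [hYdef] at hf'
    have h1 := re_tr_modular hL.gns hσ hs he (u := 1 / 2) (z := 1) (by norm_num) X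
      (cfc_apply_basis (g := Real.log) hY.isSelfAdjoint hf) hf'
    have h3 := re_tr_log hL.gns hL.map_one hσ hs he X hf'
    have h4 := re_tr_modular hL.gns hσ hs he (u := 1 / 2) (z := 1) (by norm_num) X
      (starProjection_ker_apply hY.isSelfAdjoint hf) hf'
    simp only [Real.rpow_one] at h1 h4
    have hcyc : ∀ S K Z : H →L[ℂ] H, tr (S * Z * S * K) = tr (S * K * S * Z) := by
      intro S K Z
      rw [mul_assoc (S * Z), tr_mul_comm, ← mul_assoc]
    rw [pDirichlet, if_pos rfl, oneDirichlet]
    simp only [← hYdef]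
    rw [hcyc _ (CFC.log Y - CFC.log σ), hcyc _ (Submodule.starProjection _), h4, mul_sub, sub_mul,
      sub_mul, tr_sub, Complex.sub_re, h3, CFC.log, h1]
    -- If the coefficient of `⊤` is positive, there is nothing to prove.
    have hb := hR.sum_ker_nonneg hm
    rcases hb.eq_or_lt with hb | hb
    · rw [← hb, mul_zero, EReal.coe_zero, mul_zero, add_zero, EReal.coe_le_coe_iff]
      have := hR.le_sum_log hm hb.symm
      simp only [Finset.sum_sub_distrib] at this
      linarith
    · rw [EReal.top_mul_coe_of_pos (by positivity), EReal.coe_add_top]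
      exact le_top
  · rw [pDirichlet, if_neg hp.ne', pDirichletReal_eq hL.gns hσ hs he hp hY hR hm hf,
      EReal.coe_le_coe_iff]
    have hp0 : 0 < p := by linarith
    have h5 := hR.pairSum_rpow_le hμ (inv_pos.2 hp0) (inv_lt_one_of_one_lt₀ hp)
    have hc : 0 < p / (2 * (p - 1)) := div_pos hp0 (by linarith)
    have h6 := mul_le_mul_of_nonneg_left h5 hc.le
    have h7 : p / (2 * (p - 1)) * (4 * p⁻¹ * (1 - p⁻¹)) = 2 / p := by
      have : p - 1 ≠ 0 := by linarith
      field_simp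
      ring
    rw [← mul_assoc, h7] at h6
    linarith

end Inequality

/-! ### The generator of the semigroup -/

section Generator

/-- A continuous semigroup in a Banach algebra is differentiable: for small `h` the integral of
`T s` over `[0, h]` is invertible, and its product with `T t` is the integral over `[t, t + h]`. -/
theorem exists_tendsto_semigroup_slope {A : Type*} [NormedRing A] [NormedAlgebra ℂ A]
    [CompleteSpace A] {T : ℝ → A} (hT : Continuous T) (hT0 : T 0 = 1)
    (hTadd : ∀ s t, 0 ≤ s → 0 ≤ t → T (s + t) = T s * T t) :
    ∃ D, Tendsto (fun t : ℝ => ((t : ℂ))⁻¹ • (T t - 1)) (𝓝[>] 0) (𝓝 D) := by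
  set F : ℝ → A := fun t => ∫ s in (0 : ℝ)..t, T s
  have hF : ∀ t, HasDerivAt F (T t) t := fun t => hT.integral_hasStrictDerivAt 0 t |>.hasDerivAt
  obtain ⟨h, hh, u, hu⟩ : ∃ h : ℝ, 0 < h ∧ IsUnit (F h) := by
    have hlim : Tendsto (fun t : ℝ => t⁻¹ • F t) (𝓝[>] 0) (𝓝 1) := by
      have := (hF 0).tendsto_slope_zero_right
      simpa [F, hT0] using this
    have hunit : ∀ᶠ t in 𝓝[>] (0 : ℝ), IsUnit (t⁻¹ • F t) :=
      hlim.eventually (Units.isOpen.mem_nhds isUnit_one)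
    obtain ⟨t, ht, ht0⟩ := (hunit.and self_mem_nhdsWithin).exists
    have ht0 : 0 < t := ht0
    refine ⟨t, ht0, ?_⟩
    have := ht.smul (Units.mk0 t ht0.ne')
    rwa [Units.smul_def, Units.val_mk0, smul_inv_smul₀ ht0.ne'] at this
  have hTF : ∀ t, 0 ≤ t → T t = (F (t + h) - F t) * ↑u⁻¹ := by
    intro t ht
    rw [Units.eq_mul_inv_iff_mul_eq, hu]
    have h1 : T t * F h = ∫ s in (0 : ℝ)..h, T t * T s :=
      ((ContinuousLinearMap.mul ℝ _ (T t)).intervalIntegral_comp_comm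
        (hT.intervalIntegrable 0 h)).symm
    have h2 : ∫ s in (0 : ℝ)..h, T t * T s = ∫ s in (0 : ℝ)..h, T (t + s) :=
      intervalIntegral.integral_congr fun s hs => by
        rw [Set.uIcc_of_le hh.le] at hs
        exact (hTadd t s ht hs.1).symm
    rw [h1, h2, intervalIntegral.integral_comp_add_left (fun s => T s) t, add_zero,
      intervalIntegral.integral_interval_sub_left (hT.intervalIntegrable _ _)
        (hT.intervalIntegrable _ _)]
  have hder : HasDerivAt (fun t => (F (t + h) - F t) * (↑u⁻¹ : A)) ((T (0 + h) - T 0) * ↑u⁻¹) 0 :=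
    (((hF (0 + h)).comp_add_const 0 h).sub (hF 0)).mul_const _
  refine ⟨_, hder.tendsto_slope_zero_right.congr' ?_⟩
  filter_upwards [self_mem_nhdsWithin] with t ht
  have ht : 0 < t := ht
  rw [zero_add, ← hTF t ht.le, ← hTF 0 le_rfl, hT0, ← Complex.coe_smul, Complex.ofReal_inv]

variable {H : Type*} [NormedAddCommGroup H] [InnerProductSpace ℂ H] [CompleteSpace H]
  [FiniteDimensional ℂ H] {P : QuantumMarkovSemigroup H} {L : (H →L[ℂ] H) →ₗ[ℂ] (H →L[ℂ] H)}
  {σ : H →L[ℂ] H}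

/-- The maps of the semigroup as elements of the Banach algebra of bounded maps on `B(H)`. -/
def toBounded (P : QuantumMarkovSemigroup H) (t : ℝ≥0) : (H →L[ℂ] H) →L[ℂ] (H →L[ℂ] H) :=
  LinearMap.toContinuousLinearMap (P.toMap t)

theorem toBounded_apply (t : ℝ≥0) (X : H →L[ℂ] H) : toBounded P t X = P.toMap t X := rfl

theorem toBounded_zero : toBounded P 0 = 1 := by
  ext1 X
  rw [toBounded_apply, P.map_zero]
  rfl

theorem toBounded_add (s t : ℝ≥0) : toBounded P (s + t) = toBounded P s * toBounded P t := by
  ext1 X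
  rw [toBounded_apply, P.map_add]
  rfl

theorem continuous_toBounded : Continuous (toBounded P) :=
  continuous_clm_apply.2 P.continuous

theorem exists_isGenerator (P : QuantumMarkovSemigroup H) : ∃ L, IsGenerator P L := by
  obtain ⟨D, hD⟩ := exists_tendsto_semigroup_slope (T := fun t => toBounded P t.toNNReal)
    (continuous_toBounded.comp continuous_real_toNNReal) (by simp [toBounded_zero])
    fun s t hs ht => by rw [Real.toNNReal_add hs ht, toBounded_add]
  refine ⟨D.toLinearMap, fun X => ?_⟩
  have hcoe : Tendsto (fun t : ℝ≥0 => (t : ℝ)) (𝓝[>] 0) (𝓝[>] 0) :=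
    tendsto_nhdsWithin_of_tendsto_nhds_of_eventually_within _
      ((NNReal.continuous_coe.tendsto' 0 0 rfl).mono_left nhdsWithin_le_nhds)
      (eventually_mem_nhdsWithin.mono fun t ht => NNReal.coe_pos.2 ht)
  have := ((ContinuousLinearMap.apply ℂ (H →L[ℂ] H) X).continuous.tendsto D).comp (hD.comp hcoe)
  refine this.congr fun t => ?_
  simp [toBounded_apply]

theorem isGenerator_lindbladian (P : QuantumMarkovSemigroup H) : IsGenerator P (lindbladian P) := by
  rw [lindbladian, dif_pos (exists_isGenerator P)]
  exact (exists_isGenerator P).choose_spec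

theorem IsGenerator.isGNSGenerator (hL : IsGenerator P L) (hσ : IsSelfAdjoint σ)
    (hP : ∀ t, IsGNSSymmetric σ (P.toMap t)) : IsGNSGenerator σ L where
  gns := by
    constructor
    · intro X Y
      have h1 : Tendsto (fun t : ℝ≥0 => tr (σ * (X * ((((t : ℝ) : ℂ))⁻¹ • (P.toMap t Y - Y)))))
          (𝓝[>] 0) (𝓝 (tr (σ * (X * L Y)))) :=
        (continuous_tr.tendsto _).comp (((hL Y).const_mul X).const_mul σ)
      have h2 : Tendsto (fun t : ℝ≥0 => tr (σ * (((((t : ℝ) : ℂ))⁻¹ • (P.toMap t X - X)) * Y)))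
          (𝓝[>] 0) (𝓝 (tr (σ * (L X * Y)))) :=
        (continuous_tr.tendsto _).comp (((hL X).mul_const Y).const_mul σ)
      refine tendsto_nhds_unique h1 (h2.congr fun t => ?_)
      simp only [mul_smul_comm, smul_mul_assoc, mul_sub, sub_mul, tr_smul, tr_sub,
        (hP t).tr_eq X Y]
    · intro X
      refine tendsto_nhds_unique (hL (star X)) ((hL X).star.congr fun t => ?_)
      rw [star_smul, star_sub, (hP t).map_star]
      simp
  map_one := by
    refine tendsto_nhds_unique (hL 1) ?_
    simp [P.unital]
  rate_nonneg := by
    intro e f s hs he k l g hg hkl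
    set Λ : ℝ≥0 → (H →L[ℂ] H) →ₗ[ℂ] (H →L[ℂ] H) :=
      fun t => ((((t : ℝ)⁻¹ : ℝ)) : ℂ) • (P.toMap t - LinearMap.id) with hΛ
    have hΛL : ∀ X, Tendsto (fun t => Λ t X) (𝓝[>] 0) (𝓝 (L X)) := fun X =>
      (hL X).congr fun t => by simp [hΛ]
    have hlim : Tendsto (fun t => rate e f s (Λ t) k l g) (𝓝[>] 0) (𝓝 (rate e f s L k l g)) := by
      simp only [rate_apply]
      refine (Complex.continuous_re.tendsto _).comp ?_
      refine tendsto_finsetSum _ fun a _ => tendsto_finsetSum _ fun b _ =>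
        tendsto_finsetSum _ fun c _ => tendsto_finsetSum _ fun d _ => ?_
      exact (tendsto_const_nhds.inner
        (((ContinuousLinearMap.apply ℂ H (e b)).continuous.tendsto _).comp (hΛL _))).const_mul _
    refine ge_of_tendsto' hlim fun t => ?_
    rw [hΛ, rate_smul_sub, rate_id k l g hs hkl, sub_zero]
    exact mul_nonneg (inv_nonneg.2 t.2)
      (rate_nonneg_of_completelyPositive (hP t) hσ he hs (P.completelyPositive t) k l g hg)

end Generator

/-! ### The conditional expectation onto the decoherence-free algebra -/

section DecoherenceFree

variable {H : Type*} [NormedAddCommGroup H] [InnerProductSpace ℂ H] [CompleteSpace H]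
  {P : QuantumMarkovSemigroup H} {σ : H →L[ℂ] H}

theorem norm_toMap_le (t : ℝ≥0) (X : H →L[ℂ] H) : ‖P.toMap t X‖ ≤ ‖X‖ :=
  (P.completelyPositive t).norm_apply_le (P.unital t) X

/-- The squared GNS norm `Tr[σ X^* X]`. -/
def gnsNormSq (σ X : H →L[ℂ] H) : ℝ := (tr (σ * (star X * X))).re

/-- The semigroup is isometric on the decoherence-free algebra. -/
theorem gnsNormSq_toMap_of_mem (hσ : IsInvariantState P σ) {X : H →L[ℂ] H}
    (hX : X ∈ dfAlgebra P) (t : ℝ≥0) : gnsNormSq σ (P.toMap t X) = gnsNormSq σ X := by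
  rw [gnsNormSq, ← (hX t X).1, hσ.2, gnsNormSq]

variable [FiniteDimensional ℂ H]

/-- The set of the limit points of the semigroup as `t → ∞`. -/
def limitSet (P : QuantumMarkovSemigroup H) : Set ((H →L[ℂ] H) →L[ℂ] (H →L[ℂ] H)) :=
  ⋂ n : ℕ, closure (toBounded P '' Set.Ici (n : ℝ≥0))

theorem mem_of_mem_limitSet {E : (H →L[ℂ] H) →L[ℂ] (H →L[ℂ] H)} (hE : E ∈ limitSet P)
    {C : Set ((H →L[ℂ] H) →L[ℂ] (H →L[ℂ] H))} (hC : IsClosed C) (t₀ : ℝ≥0)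
    (h : ∀ t, t₀ ≤ t → toBounded P t ∈ C) : E ∈ C := by
  obtain ⟨n, hn⟩ := exists_nat_ge t₀
  refine closure_minimal ?_ hC (Set.mem_iInter.1 hE n)
  rintro _ ⟨t, ht, rfl⟩
  exact h t (hn.trans ht)

/-- The limit points form a compact semigroup, which contains an idempotent. -/
theorem exists_idempotent_mem_limitSet (P : QuantumMarkovSemigroup H) :
    ∃ E ∈ limitSet P, E * E = E := by
  have : ProperSpace ((H →L[ℂ] H) →L[ℂ] (H →L[ℂ] H)) := FiniteDimensional.proper ℂ _
  have hsub : ∀ n : ℕ, closure (toBounded P '' Set.Ici (n : ℝ≥0)) ⊆ Metric.closedBall 0 1 := by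
    intro n
    refine closure_minimal ?_ Metric.isClosed_closedBall
    rintro _ ⟨t, -, rfl⟩
    rw [mem_closedBall_zero_iff]
    exact ContinuousLinearMap.opNorm_le_bound _ zero_le_one fun X => by
      rw [one_mul]
      exact norm_toMap_le t X
  have hcomp : ∀ n : ℕ, IsCompact (closure (toBounded P '' Set.Ici (n : ℝ≥0))) := fun n =>
    (isCompact_closedBall _ _).of_isClosed_subset isClosed_closure (hsub n)
  refine exists_idempotent_in_compact_subsemigroup
    (fun r : (H →L[ℂ] H) →L[ℂ] (H →L[ℂ] H) => continuous_mul_const r) (limitSet P) ?_ ?_ ?_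
  · refine IsCompact.nonempty_iInter_of_sequence_nonempty_isCompact_isClosed _ (fun n => ?_)
      (fun n => ?_) (hcomp 0) fun n => isClosed_closure
    · refine closure_mono (Set.image_mono (Set.Ici_subset_Ici.2 ?_))
      exact_mod_cast n.le_succ
    · exact (Set.Nonempty.image _ Set.nonempty_Ici).closure
  · exact (hcomp 0).of_isClosed_subset (isClosed_iInter fun n => isClosed_closure)
      (Set.iInter_subset _ 0)
  · intro x hx y hy
    refine Set.mem_iInter.2 fun n => map_mem_closure₂ continuous_mul (Set.mem_iInter.1 hx n)
      (Set.mem_iInter.1 hy n) ?_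
    rintro _ ⟨s, hs, rfl⟩ _ ⟨t, -, rfl⟩
    exact ⟨s + t, Set.mem_Ici.2 ((Set.mem_Ici.1 hs).trans le_self_add), toBounded_add s t⟩

theorem continuous_gnsNormSq : Continuous (gnsNormSq σ) := by
  unfold gnsNormSq
  exact Complex.continuous_re.comp (continuous_tr.comp (by fun_prop))

theorem gnsNormSq_toMap_le (hσ : IsInvariantState P σ) (t : ℝ≥0) (X : H →L[ℂ] H) :
    gnsNormSq σ (P.toMap t X) ≤ gnsNormSq σ X := by
  have := re_tr_mul_nonneg hσ.1.1 ((P.completelyPositive t).schwarz (P.unital t) X)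
  rw [mul_sub, tr_sub, hσ.2, Complex.sub_re] at this
  exact sub_nonneg.1 this

/-- If `P_t` does not decrease the GNS norm of `X`, then the Schwarz inequality is an equality for
`X`, so that `X` is in the multiplicative domain of `P_t`. -/
theorem map_star_mul_of_gnsNormSq_le (hσ : IsInvariantState P σ) (hσ' : IsStrictlyPositive σ)
    {t : ℝ≥0} {X : H →L[ℂ] H} (h : gnsNormSq σ X ≤ gnsNormSq σ (P.toMap t X)) (Y : H →L[ℂ] H) :
    P.toMap t (star X * Y) = star (P.toMap t X) * P.toMap t Y := by
  refine (P.completelyPositive t).map_star_mul (P.unital t) (sub_eq_zero.1 ?_) Y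
  refine eq_zero_of_re_tr_mul_eq_zero hσ' ((P.completelyPositive t).schwarz (P.unital t) X) ?_
  rw [mul_sub, tr_sub, hσ.2, Complex.sub_re]
  exact sub_eq_zero.2 (le_antisymm h (gnsNormSq_toMap_le hσ t X))

/-- The conditional expectation onto the decoherence-free algebra exists when there is a faithful
invariant state: every idempotent limit point `E` of the semigroup will do. If `E X = 0`,
then `P_t X` comes close to zero, and stays there by contractivity. -/
theorem exists_isDFExpectation (hP : HasFaithfulInvariantState P) : ∃ E, IsDFExpectation P E := by
  obtain ⟨σ, ⟨hσ', -⟩, hσ⟩ := hP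
  obtain ⟨E, hE, hEE⟩ := exists_idempotent_mem_limitSet P
  have happ : ∀ X, Continuous fun Φ : (H →L[ℂ] H) →L[ℂ] (H →L[ℂ] H) => Φ X := fun X =>
    (ContinuousLinearMap.apply ℂ (H →L[ℂ] H) X).continuous
  have hcp : IsCompletelyPositive E.toLinearMap :=
    mem_of_mem_limitSet hE isClosed_completelyPositive 0 fun t _ => P.completelyPositive t
  have hEEX : ∀ X, E (E X) = E X := fun X => congrArg (fun Φ => Φ X) hEE
  have hker : ∀ X, E X = 0 ↔ Tendsto (fun t : ℝ≥0 => P.toMap t X) atTop (𝓝 0) := by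
    intro X
    constructor
    · intro h0
      rw [Metric.tendsto_atTop]
      intro ε hε
      obtain ⟨_, hΦ, ⟨t, -, rfl⟩⟩ := mem_closure_iff.1 (Set.mem_iInter.1 hE 0)
        ((fun Φ => Φ X) ⁻¹' Metric.ball 0 ε) (Metric.isOpen_ball.preimage (happ X))
        (by simpa [h0] using hε)
      refine ⟨t, fun s hs => ?_⟩
      have ht : ‖P.toMap t X‖ < ε := by simpa [toBounded_apply] using hΦ
      obtain ⟨r, rfl⟩ := exists_add_of_le hs
      rw [dist_zero_right, add_comm t r, P.map_add]
      exact (norm_toMap_le r _).trans_lt ht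
    · intro hlim
      refine norm_le_zero_iff.1 (le_of_forall_pos_le_add fun ε hε => ?_)
      obtain ⟨t₀, ht₀⟩ := (Metric.tendsto_atTop.1 hlim) ε hε
      refine mem_of_mem_limitSet hE (C := {Φ | ‖Φ X‖ ≤ 0 + ε})
        (isClosed_le (happ X).norm continuous_const) t₀ fun t ht => ?_
      rw [zero_add]
      simpa [toBounded_apply] using (ht₀ t ht).le
  have hmem : ∀ X, E X ∈ dfAlgebra P := by
    -- On the range of `E` the semigroup is recurrent, so that it cannot decrease the GNS norm.
    have hq : ∀ X t, gnsNormSq σ (E X) ≤ gnsNormSq σ (P.toMap t (E X)) := by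
      intro X t
      have := mem_of_mem_limitSet hE
        (C := {Φ | gnsNormSq σ (Φ (E X)) ≤ gnsNormSq σ (P.toMap t (E X))})
        (isClosed_le (continuous_gnsNormSq.comp (happ _)) continuous_const) t fun s hs => by
          obtain ⟨r, rfl⟩ := exists_add_of_le hs
          rw [add_comm t r, Set.mem_ofPred_eq, toBounded_apply, P.map_add]
          exact gnsNormSq_toMap_le hσ r _
      rwa [Set.mem_ofPred_eq, hEEX] at this
    intro X t Y
    refine ⟨map_star_mul_of_gnsNormSq_le hσ hσ' (hq X t) Y, ?_⟩
    have hXs : E (star X) = star (E X) := hcp.map_star X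
    have h1 := map_star_mul_of_gnsNormSq_le hσ hσ' (hq (star X) t) (star Y)
    have h2 := congrArg star h1
    rw [hXs] at h2
    simpa [← (P.completelyPositive t).map_star] using h2
  refine ⟨E.toLinearMap, hcp, LinearMap.ext hEEX, ?_, ?_, hker⟩
  · refine Set.Subset.antisymm ?_ ?_
    · rintro _ ⟨X, rfl⟩
      exact hmem X
    · intro X hX
      have hsub : X - E X ∈ dfAlgebra P := by
        intro t Y
        have h1 := hX t Y
        have h2 := hmem X t Y
        simp only [star_sub, map_sub, sub_mul, mul_sub, h1.1, h1.2, h2.1, h2.2, and_self]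
      -- `X - E X` tends to zero, while its GNS norm is constant.
      have hlim := (hker (X - E X)).1 (by rw [map_sub, hEEX, sub_self])
      have hq : gnsNormSq σ (X - E X) = 0 := by
        have h1 := (continuous_gnsNormSq (σ := σ).tendsto 0).comp hlim
        have h2 : gnsNormSq σ 0 = 0 := by simp [gnsNormSq, tr]
        rw [h2] at h1
        refine tendsto_nhds_unique ?_ h1
        simp only [Function.comp_def, gnsNormSq_toMap_of_mem hσ hsub]
        exact tendsto_const_nhds
      have h0 := eq_zero_of_re_tr_mul_eq_zero hσ' (star_mul_self_nonneg _) hq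
      rw [CStarRing.star_mul_self_eq_zero_iff, sub_eq_zero] at h0
      exact ⟨X, h0.symm⟩
  · intro ρ hρ X
    exact mem_of_mem_limitSet hE (C := {Φ | tr (ρ * Φ X) = tr (ρ * X)})
      (isClosed_eq (continuous_tr.comp (continuous_const.mul (happ X))) continuous_const) 0
      fun t _ => hρ.2 t X

theorem isDFExpectation_dfExpectation (hP : HasFaithfulInvariantState P) :
    IsDFExpectation P (dfExpectation P) := by
  rw [dfExpectation, dif_pos (exists_isDFExpectation hP)]
  exact (exists_isDFExpectation hP).choose_spec

end DecoherenceFree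

/-! ### The reference state -/

section ReferenceState

open InnerProductSpace ComplexOrder

variable {H : Type*} [NormedAddCommGroup H] [InnerProductSpace ℂ H] [CompleteSpace H]
  [FiniteDimensional ℂ H] {P : QuantumMarkovSemigroup H}

theorem isStrictlyPositive_of_inner_pos {A : H →L[ℂ] H} (h0 : ∀ v, 0 ≤ inner ℂ v (A v))
    (hpos : ∀ v, inner ℂ v (A v) = 0 → v = 0) : IsStrictlyPositive A := by
  have hA : 0 ≤ A := by
    rw [ContinuousLinearMap.nonneg_iff_isPositive, ContinuousLinearMap.isPositive_iff_complex]
    intro v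
    obtain ⟨r, hr, hrv⟩ := RCLike.nonneg_iff_exists_ofReal.1 (h0 v)
    have : inner ℂ (A v) v = (r : ℂ) := by
      rw [← inner_conj_symm, ← hrv]
      exact Complex.conj_ofReal r
    simpa [this] using hr
  have hinj : Function.Injective A := (injective_iff_map_eq_zero A).2 fun v hv =>
    hpos v (by rw [hv, inner_zero_right])
  exact (ContinuousLinearMap.isUnit_iff_bijective.2
    ⟨hinj, (LinearMap.injective_iff_surjective (f := A.toLinearMap)).1 hinj⟩).isStrictlyPositive hA

theorem inner_sigmaTr (v : H) : inner ℂ v (sigmaTr P v)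
    = (Module.finrank ℂ H : ℂ)⁻¹ * tr (dfExpectation P (rankOne ℂ v v)) := by
  rw [← tr_mul_rankOne, tr_mul_comm, sigmaTr, ← tr_predual, mul_smul_comm, mul_one, tr_smul]

/-- The reference state `σ_Tr` is positive definite: `⟨v, σ_Tr v⟩ = Tr[E_N(|v⟩⟨v|)] / d`, and
`E_N` is faithful, because an invariant state `ρ` satisfies `Tr[ρ E_N(X)] = Tr[ρ X]`. -/
theorem isStrictlyPositive_sigmaTr (hP : HasFaithfulInvariantState P) :
    IsStrictlyPositive (sigmaTr P) := by
  have hE := isDFExpectation_dfExpectation hP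
  have hnn : ∀ v : H, 0 ≤ dfExpectation P (rankOne ℂ v v) := fun v =>
    hE.completelyPositive.map_nonneg
      ((ContinuousLinearMap.nonneg_iff_isPositive _).2 (isPositive_rankOne_self v))
  refine isStrictlyPositive_of_inner_pos (fun v => ?_) fun v hv => ?_
  · rw [inner_sigmaTr]
    refine mul_nonneg (by simp) (LinearMap.IsPositive.trace_nonneg ?_)
    exact (ContinuousLinearMap.isPositive_toLinearMap_iff _).2
      ((ContinuousLinearMap.nonneg_iff_isPositive _).1 (hnn v))
  · by_contra hv0
    have : Nontrivial H := ⟨v, 0, hv0⟩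
    rw [inner_sigmaTr, mul_eq_zero, inv_eq_zero, Nat.cast_eq_zero] at hv
    have htr := hv.resolve_left Module.finrank_pos.ne'
    have hE0 : dfExpectation P (rankOne ℂ v v) = 0 :=
      eq_zero_of_re_tr_mul_eq_zero isStrictlyPositive_one (hnn v) (by rw [one_mul, htr]; rfl)
    obtain ⟨ρ, ⟨hρ, -⟩, hinv⟩ := hP
    have h := hE.compatible ρ hinv (rankOne ℂ v v)
    rw [hE0, mul_zero, tr_mul_rankOne] at h
    have hpos := re_inner_pos_of_isStrictlyPositive hρ hv0
    rw [← h] at hpos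
    simp [tr] at hpos

theorem IsDBC.isGNSSymmetric (hP : IsDBC P) (t : ℝ≥0) :
    IsGNSSymmetric (sigmaTr P) (P.toMap t) where
  tr_eq X Y := by simpa using hP.2 (star X) Y t
  map_star := (P.completelyPositive t).map_star

end ReferenceState

end QMS

end

theorem theorem4p1 {H : Type*} [NormedAddCommGroup H] [InnerProductSpace ℂ H] [CompleteSpace H]
    [FiniteDimensional ℂ H] (P : QMS.QuantumMarkovSemigroup H) (hP : QMS.IsDBC P)
    (p : ℝ) (hp : 1 ≤ p) (X : H →L[ℂ] H) (hX : 0 ≤ X) :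
    ((2 / p : ℝ) : EReal) *
        QMS.pDirichlet (QMS.sigmaTr P) (QMS.lindbladian P) 2 (QMS.powerMap (QMS.sigmaTr P) 2 p X)
      ≤ QMS.pDirichlet (QMS.sigmaTr P) (QMS.lindbladian P) p X := by
  have hσ := QMS.isStrictlyPositive_sigmaTr hP.1
  exact ((QMS.isGenerator_lindbladian P).isGNSGenerator hσ.isSelfAdjoint
    hP.isGNSSymmetric).regular hσ hp hX
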